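/- Let $X$ be a Hausdorff $C^\infty$ manifold without boundary, modeled on a real Hilbert space $\mathbf H$ of finite or infinite dimension, with a smooth strong Riemannian metric, i.e. a smoothly varying family of inner products on the tangent spaces $T_xX$, each of which induces the given topology of $T_xX$. (A complex Hilbert manifold with a Hermitian metric is included: regard it as a real manifold with the real part of the metric.) Let $F\colon TX\to T(TX)$ be the metric spray, let $\mathcal D\subseteq TX$ be the set of vectors $v$ for which the integral curve $\beta_v$ of $F$ with $\beta_v(0)=v$ is defined on $[0,1]$, and let $f\colon\mathcal D\to X$, $f(v)=\pi(\beta_v(1))$, be the exponential map, where $\pi\colon TX\to X$ is the projection. Let $G$ be an arbitrary (discrete) group acting on $X$ by smooth isometries; it acts on $TX$ by derivatives. Let $Y\subseteq X$ be a $G$-invariant smooth, locally closed submanifold, i.e. near each of its points $Y$ is a closed affine subspace of $\mathbf H$ in a suitable smooth chart of $X$. Let $N(Y)=\{v\in T_yX : y\in Y,\ v\perp T_yY\}$ be its normal bundle, and assume that $N(Y)$ is a smooth subbundle of $TX|_Y$. Then there are a $G$-invariant open neighborhood $Z$ of the zero section in $N(Y)$ with $Z\subseteq\mathcal D\cap N(Y)$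 and an open neighborhood $V$ of $Y$ in $X$ such that $f$ restricts to a $G$-equivariant diffeomorphism $f\colon Z\to V$. Moreover $V$ is $G$-invariant and $f(0_y)=y$ for every $y\in Y$. Hence $V$, together with $f\colon Z\to V$, is a smooth $G$-invariant (not necessarily total) tubular neighborhood of $Y$ in $X$. -/

import Mathlib

open Set Filter Topology Manifold Bundle
open scoped ContDiff

noncomputable section

/-! Strong Riemannian metrics on Hilbert manifolds.

Manifolds are modelled on a real Hilbert space `E`, without boundary. A complex Hilbert space is
a real one (`InnerProductSpace.complexToReal`), and a Hermitian metric is used through its real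
part, which has the same orthogonal complements of complex subspaces. Smooth means `C^∞` over `ℝ`.
Neither second countability nor partitions of unity are assumed. -/

/-- A smooth strong Riemannian metric on `X`: a smooth section of symmetric positive definite
continuous bilinear forms on the tangent spaces, whose unit balls are bounded, so that each form
induces the given topology of the tangent space. -/
abbrev StrongMetric (E : Type*) [NormedAddCommGroup E] [InnerProductSpace ℝ E]
    (X : Type*) [TopologicalSpace X] [ChartedSpace E X] [IsManifold 𝓘(ℝ, E) ∞ X] :=
  ContMDiffRiemannianMetric 𝓘(ℝ, E) ∞ E (fun x : X => TangentSpace 𝓘(ℝ, E) x)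

section Geometry

variable {E : Type*} [NormedAddCommGroup E] [InnerProductSpace ℝ E]
  {X : Type*} [TopologicalSpace X] [ChartedSpace E X] [IsManifold 𝓘(ℝ, E) ∞ X]

/-! ### The metric spray and the exponential map -/

/-- The coordinate expression of the metric in the preferred chart at `x`: the pullback of the
metric under the inverse of the chart. -/
def metricInChart (g : StrongMetric E X) (x : X) (q : E) : E →L[ℝ] E →L[ℝ] ℝ :=
  let A : E →L[ℝ] E := mfderiv 𝓘(ℝ, E) 𝓘(ℝ, E) (extChartAt 𝓘(ℝ, E) x).symm q
  let B : E →L[ℝ] E →L[ℝ] ℝ := g.inner ((extChartAt 𝓘(ℝ, E) x).symm q)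
  B.bilinearComp A A

/-- Riesz representation for a strong metric. -/
theorem StrongMetric.exists_riesz [CompleteSpace E] (g : StrongMetric E X) (x : X)
    (L : E →L[ℝ] ℝ) :
    ∃ u : E, ∀ w : E, g.inner x u w = L w := by
  let B : E →L[ℝ] E →L[ℝ] ℝ := g.inner x
  have hb : Bornology.IsVonNBounded ℝ {v : E | B v v < 1} := g.isVonNBounded x
  obtain ⟨R, hR, hball⟩ :=
    ((NormedSpace.isVonNBounded_iff ℝ).1 hb).subset_ball_lt 0 (0 : E)
  have hco : IsCoercive B := by
    refine ⟨(R ^ 2)⁻¹, by positivity, fun v => ?_⟩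
    by_cases hv : v = 0
    · simp [hv]
    have hpos : 0 < B v v := g.pos x v hv
    by_contra! hlt
    have hn : 0 < ‖v‖ := norm_pos_iff.2 hv
    have hmem : (R / ‖v‖) • v ∈ {v : E | B v v < 1} := by
      have h1 : B ((R / ‖v‖) • v) ((R / ‖v‖) • v) = (R / ‖v‖) ^ 2 * B v v := by
        simp only [map_smul, FunLike.coe_smul, Pi.smul_apply, smul_eq_mul]
        ring
      show B _ _ < 1
      rw [h1]
      calc (R / ‖v‖) ^ 2 * B v v < (R / ‖v‖) ^ 2 * ((R ^ 2)⁻¹ * ‖v‖ * ‖v‖) := by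
            gcongr
        _ = 1 := by field_simp
    have h2 := hball hmem
    rw [mem_ball_zero_iff, norm_smul, Real.norm_of_nonneg (by positivity),
      div_mul_cancel₀ _ hn.ne'] at h2
    exact lt_irrefl _ h2
  refine ⟨hco.continuousLinearEquivOfBilin.symm ((InnerProductSpace.toDual ℝ E).symm L), ?_⟩
  intro w
  have h3 := hco.continuousLinearEquivOfBilin_apply
    (hco.continuousLinearEquivOfBilin.symm ((InnerProductSpace.toDual ℝ E).symm L)) w
  rw [ContinuousLinearEquiv.apply_symm_apply, InnerProductSpace.toDual_symm_apply] at h3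
  exact h3.symm

set_option synthInstance.maxHeartbeats 200000 in
/-- The linear form `w ↦ (1/2) ∂_w g(v, v) - ∂_v g(v, w)` at `x`, in the preferred chart at `x`. -/
def sprayForm (g : StrongMetric E X) (x : X) (v : E) : E →L[ℝ] ℝ :=
  let D : E →L[ℝ] E →L[ℝ] E →L[ℝ] ℝ :=
    fderiv ℝ (metricInChart g x) (extChartAt 𝓘(ℝ, E) x x)
  (1 / 2 : ℝ) • (D.flip v).flip v - D v v

/-- The acceleration `f_x(v)` of the geodesic with position `x` and velocity `v`, in the preferred
chart at `x`: the unique `u` such that `g_x(u, w) = (1/2) ∂_w g(v, v) - ∂_v g(v, w)` for all `w`,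
which is the geodesic equation `u = - Γ_x(v, v)`. -/
def sprayAccel [CompleteSpace E] (g : StrongMetric E X) (x : X) (v : E) : E :=
  (g.exists_riesz x (sprayForm g x v)).choose

/-- The metric spray, a vector field on the tangent bundle, `(x, v) ↦ (x, v, v, f_x(v))` in local
coordinates. The tangent space of `TX` at `p` is identified with `E × E` through the chart of `TX`
induced by the preferred chart of `X` at the base point of `p`. -/
def metricSpray [CompleteSpace E] (g : StrongMetric E X) (p : TangentBundle 𝓘(ℝ, E) X) :
    TangentSpace (𝓘(ℝ, E)).tangent p :=
  ((p.2, sprayAccel g p.1 p.2) : E × E)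

/-- `β` is an integral curve of the metric spray, with initial value `p`, on an open interval that
contains `[0, 1]`. -/
def IsSprayCurve [CompleteSpace E] (g : StrongMetric E X) (p : TangentBundle 𝓘(ℝ, E) X)
    (β : ℝ → TangentBundle 𝓘(ℝ, E) X) : Prop :=
  β 0 = p ∧ ∃ ε > 0, IsMIntegralCurveOn (I := (𝓘(ℝ, E)).tangent) β (metricSpray g)
    (Ioo (-ε) (1 + ε))

/-- The domain of the exponential map: the tangent vectors whose integral curve of the spray
is defined on `[0, 1]`. -/
def expDomain [CompleteSpace E] (g : StrongMetric E X) : Set (TangentBundle 𝓘(ℝ, E) X) :=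
  {p | ∃ β, IsSprayCurve g p β}

open Classical in
/-- The exponential map `p ↦ π (β_p 1)`, where `β_p` is the integral curve of the spray that starts
at `p` (integral curves are unique on Hausdorff manifolds). Outside of its domain
the value is irrelevant. -/
def riemannianExp [CompleteSpace E] (g : StrongMetric E X) (p : TangentBundle 𝓘(ℝ, E) X) : X :=
  if h : p ∈ expDomain g then ((Exists.choose h) 1).proj else p.proj

/-! ### Submanifolds and their normal bundles -/

/-- `Y` is a smooth (locally closed) submanifold of `X`: around each point of `Y` there is a smooth
chart of `X` in which `Y` is a closed affine subspace. The subspaces at different points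
need not be isomorphic. -/
def IsSmoothSubmanifold (E : Type*) [NormedAddCommGroup E] [InnerProductSpace ℝ E]
    {X : Type*} [TopologicalSpace X] [ChartedSpace E X] (Y : Set X) : Prop :=
  ∀ y ∈ Y, ∃ φ ∈ IsManifold.maximalAtlas 𝓘(ℝ, E) ∞ X, y ∈ φ.source ∧
    ∃ F : Submodule ℝ E, IsClosed (F : Set E) ∧ ∀ x ∈ φ.source, x ∈ Y ↔ φ x - φ y ∈ F

/-- The tangent bundle `TY` as a subset of `TX`: the velocities at time `0` of the smooth curves
in `Y`. -/
def tangentSet (E : Type*) [NormedAddCommGroup E] [InnerProductSpace ℝ E]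
    {X : Type*} [TopologicalSpace X] [ChartedSpace E X] [IsManifold 𝓘(ℝ, E) ∞ X] (Y : Set X) :
    Set (TangentBundle 𝓘(ℝ, E) X) :=
  {p | ∃ γ : ℝ → X, ContMDiffAt 𝓘(ℝ, ℝ) 𝓘(ℝ, E) ∞ γ 0 ∧ (∀ᶠ t in 𝓝 (0 : ℝ), γ t ∈ Y) ∧
    p = ⟨γ 0, mfderiv 𝓘(ℝ, ℝ) 𝓘(ℝ, E) γ 0 (1 : ℝ)⟩}

/-- The normal bundle `N(Y) ⊆ TX`: the vectors at points of `Y` that are orthogonal to `TY`. -/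
def normalBundle (g : StrongMetric E X) (Y : Set X) : Set (TangentBundle 𝓘(ℝ, E) X) :=
  {p | p.1 ∈ Y ∧ ∀ w : TangentSpace 𝓘(ℝ, E) p.1,
    (⟨p.1, w⟩ : TangentBundle 𝓘(ℝ, E) X) ∈ tangentSet E Y → g.inner p.1 p.2 w = 0}

/-- `S` is a smooth subbundle of `TX|_Y`: around each point `y` of `Y`, there is a smooth local
trivialization of `TX|_Y` that carries `S` to the product of the base with a closed subspace `K`
of `E`. The trivialization is the standard one over the preferred chart at `y`, followed by a
family `Φ` of linear automorphisms of `E` that depends smoothly on the point of `Y`. -/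
def IsSmoothSubbundleOver (Y : Set X) (S : Set (TangentBundle 𝓘(ℝ, E) X)) : Prop :=
  (∀ p ∈ S, p.1 ∈ Y) ∧
  ∀ y ∈ Y, ∃ W : Set X, IsOpen W ∧ y ∈ W ∧ W ⊆ (chartAt E y).source ∧
    ∃ K : Submodule ℝ E, IsClosed (K : Set E) ∧ ∃ Φ : X → E ≃L[ℝ] E,
      ContMDiffOn 𝓘(ℝ, E) 𝓘(ℝ, E →L[ℝ] E) ∞ (fun x => (Φ x : E →L[ℝ] E)) (W ∩ Y) ∧
      ∀ p : TangentBundle 𝓘(ℝ, E) X, p.1 ∈ W ∩ Y →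
        (p ∈ S ↔ Φ p.1 (trivializationAt E (TangentSpace 𝓘(ℝ, E)) y p).2 ∈ K)

/-! ### Group actions -/

/-- `G` acts on `X` by smooth isometries of the metric. -/
def ActsBySmoothIsometries (G : Type*) [Group G] [MulAction G X] (g : StrongMetric E X) : Prop :=
  ∀ a : G, ContMDiff 𝓘(ℝ, E) 𝓘(ℝ, E) ∞ (fun x : X => a • x) ∧
    ∀ (x : X) (v w : TangentSpace 𝓘(ℝ, E) x),
      g.inner (a • x) (mfderiv 𝓘(ℝ, E) 𝓘(ℝ, E) (fun z : X => a • z) x v)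
        (mfderiv 𝓘(ℝ, E) 𝓘(ℝ, E) (fun z : X => a • z) x w) = g.inner x v w

/-- The induced action of an element of `G` on `TX`, by the derivative. -/
def tangentAct (E : Type*) [NormedAddCommGroup E] [InnerProductSpace ℝ E]
    {X : Type*} [TopologicalSpace X] [ChartedSpace E X] [IsManifold 𝓘(ℝ, E) ∞ X]
    {G : Type*} [Group G] [MulAction G X] (a : G) :
    TangentBundle 𝓘(ℝ, E) X → TangentBundle 𝓘(ℝ, E) X :=
  tangentMap 𝓘(ℝ, E) 𝓘(ℝ, E) (fun x : X => a • x)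

/-! ### Tubular neighborhoods -/

/-- `f` restricts to a diffeomorphism from `U` (an open subset of a submanifold of `TX`) onto the
open subset `V` of `X`: a bijection that is smooth with smooth inverse. Smoothness on `U` is
smoothness as a function on a subset of `TX`, and smoothness into `U` is smoothness into `TX`;
on submanifolds, this is smoothness for the submanifold structure. -/
def IsDiffeoOn (f : TangentBundle 𝓘(ℝ, E) X → X) (U : Set (TangentBundle 𝓘(ℝ, E) X))
    (V : Set X) : Prop :=
  BijOn f U V ∧ ContMDiffOn (𝓘(ℝ, E)).tangent 𝓘(ℝ, E) ∞ f U ∧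
    ∃ ψ : X → TangentBundle 𝓘(ℝ, E) X,
      InvOn ψ f U V ∧ ContMDiffOn 𝓘(ℝ, E) (𝓘(ℝ, E)).tangent ∞ ψ V

/-- `U` is an open neighborhood of the zero section in `N(Y)`. -/
def IsOpenNhdOfZeroSection (g : StrongMetric E X) (Y : Set X)
    (U : Set (TangentBundle 𝓘(ℝ, E) X)) : Prop :=
  (∃ O : Set (TangentBundle 𝓘(ℝ, E) X), IsOpen O ∧ U = O ∩ normalBundle g Y) ∧
    ∀ y ∈ Y, (⟨y, 0⟩ : TangentBundle 𝓘(ℝ, E) X) ∈ U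

/-- The open neighborhood `V` of `Y`, together with `φ : U → V`, is a smooth (not necessarily
total) tubular neighborhood of `Y` in `X`. -/
structure IsSmoothTubularNhd (g : StrongMetric E X) (Y : Set X)
    (U : Set (TangentBundle 𝓘(ℝ, E) X)) (V : Set X) (φ : TangentBundle 𝓘(ℝ, E) X → X) : Prop where
  isOpenNhdOfZeroSection : IsOpenNhdOfZeroSection g Y U
  isOpen : IsOpen V
  subset : Y ⊆ V
  isDiffeoOn : IsDiffeoOn φ U V
  apply_zero : ∀ y ∈ Y, φ ⟨y, 0⟩ = y

end Geometry

end

/-! Equivariant tubular neighborhoods by the exponential map.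

The tube is assembled from local tubes. Around the zero vector at a point `y` of `Y`, work in a
chart in which `Y` is a closed affine subspace with direction `F`. The exponential map is smooth
there with derivative `(a, b) ↦ a + b`, since the spray is quadratic in the velocity
(`exists_timeOneMap`, `exists_riemannianExp_tangentChartSymm`), and the normal bundle is the zero
set of the smooth map `normalDefect`. The derivative of the pair of these two maps is bijective,
because for a strong metric the closed subspace `F` has an orthogonal complement
(`bijective_prod_normalDefectDeriv`). By the inverse function theorem the pair is a local
diffeomorphism, and it carries the normal bundle to the zero set of the second coordinate. This
gives the local tube of `exists_isExpTube`.

In infinite dimension smooth dependence on initial conditions is obtained from the inverse function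
theorem as well, applied to the composition operator `a ↦ A ∘ motion a` on a space of continuous
functions (`contDiffOn_postComp`).

To glue, one needs a distance on `X` that induces the topology and is invariant under isometries.
Regularity of `X` is not assumed, but a Hausdorff manifold with a strong metric is metrizable by
`metricDist`: completeness of the model space and the Hausdorff property show that a curve of small
length cannot leave a chart (`HasSpeedLE.mem_ball`, `hasBasis_nhds_metricDist`). A radius `r` is
admissible at `y` if the short normal vectors near `y`, in terms of `r`, lie in one local tube
(`IsTubeRadius`). Admissibility is invariant under isometries, and a radius decreases at most by the
distance when the base point moves (`IsTubeRadius.of_add_le`). The global tube `tubeSource` consists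
of the normal vectors `p` for which some admissible `r` at the base point exceeds `|p|²` and four
times the distance from the base point to the image of `p`. If two of these have the same image,
then their base points are so close that both vectors lie in the local tube of the larger radius,
where the exponential map is injective (`injOn_riemannianExp_tubeSource`). All conditions are open
and invariant.

Equivariance holds because isometries preserve the spray, by the transformation law `geodAccel_map`,
and because integral curves of the spray are unique (`IsSprayCurve.apply_one_eq`). -/

noncomputable section

set_option maxSynthPendingDepth 3

/-! ### The inverse function theorem on open sets -/

section InverseFunction

variable {E F : Type*} [NormedAddCommGroup E] [NormedSpace ℝ E] [CompleteSpace E]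
  [NormedAddCommGroup F] [NormedSpace ℝ F]

/-- The smooth inverse function theorem. `ContDiffAt ℝ ∞` at one point does not give a neighborhood
on which the function is smooth, so smoothness is assumed, and obtained for the inverse, on open
sets. -/
theorem exists_openPartialHomeomorph_contDiffOn_symm {f : E → F} {S : Set E} {x : E}
    (hS : IsOpen S) (hx : x ∈ S) (hf : ContDiffOn ℝ ∞ f S) (f' : E ≃L[ℝ] F)
    (hf' : HasFDerivAt f (f' : E →L[ℝ] F) x) :
    ∃ Φ : OpenPartialHomeomorph E F, x ∈ Φ.source ∧ Φ.source ⊆ S ∧ (∀ z, Φ z = f z) ∧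
      ContDiffOn ℝ ∞ Φ.symm Φ.target := by
  have hfx : ContDiffAt ℝ ∞ f x := hf.contDiffAt (hS.mem_nhds hx)
  have hne : (∞ : WithTop ℕ∞) ≠ 0 := by simp
  have hcont : ContinuousOn (fderiv ℝ f) S := hf.continuousOn_fderiv_of_isOpen hS (by simp)
  set T : Set E := S ∩ fderiv ℝ f ⁻¹' range ((↑) : (E ≃L[ℝ] F) → E →L[ℝ] F) with hT
  have hTo : IsOpen T := hcont.isOpen_inter_preimage hS ContinuousLinearEquiv.isOpen
  have hxT : x ∈ T := ⟨hx, f', hf'.fderiv.symm⟩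
  refine ⟨(hfx.toOpenPartialHomeomorph f hf' hne).restrOpen T hTo, ?_, ?_, fun z => rfl, ?_⟩
  · exact ⟨hfx.mem_toOpenPartialHomeomorph_source hf' hne, hxT⟩
  · exact fun z hz => hz.2.1
  · intro w hw
    have hz := ((hfx.toOpenPartialHomeomorph f hf' hne).restrOpen T hTo).map_target hw
    set z := ((hfx.toOpenPartialHomeomorph f hf' hne).restrOpen T hTo).symm w with hzdef
    obtain ⟨e, he⟩ := hz.2.2
    have hfz : ContDiffAt ℝ ∞ f z := hf.contDiffAt (hS.mem_nhds hz.2.1)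
    refine (OpenPartialHomeomorph.contDiffAt_symm _ hw (f₀' := e) ?_ hfz).contDiffWithinAt
    rw [he]
    exact (hfz.differentiableAt hne).hasFDerivAt

end InverseFunction

/-! ### The geodesic equation in a Hilbert space -/

section Geodesic

variable {E : Type*} [NormedAddCommGroup E] [NormedSpace ℝ E]

/-- The linear form `w ↦ (1/2) ∂_w G(v, v) - ∂_v G(v, w)` at `q`, for a metric `G` given on an open
subset of the model space. -/
def geodForm (G : E → E →L[ℝ] E →L[ℝ] ℝ) (q v : E) : E →L[ℝ] ℝ :=
  let D : E →L[ℝ] E →L[ℝ] E →L[ℝ] ℝ := fderiv ℝ G q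
  (1 / 2 : ℝ) • (D.flip v).flip v - D v v

/-- The acceleration at `q` of the geodesic with velocity `v`, for a metric `G` given on an open
subset of the model space: the vector that represents `geodForm G q v` for the form `G q`. -/
def geodAccel (G : E → E →L[ℝ] E →L[ℝ] ℝ) (q v : E) : E :=
  (G q).inverse (geodForm G q v)

variable {G : E → E →L[ℝ] E →L[ℝ] ℝ}

theorem geodForm_apply (q v w : E) :
    geodForm G q v w = 1 / 2 * fderiv ℝ G q w v v - fderiv ℝ G q v v w := by
  simp [geodForm]

theorem apply_geodAccel {q : E} (h : (G q).IsInvertible) (v : E) :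
    G q (geodAccel G q v) = geodForm G q v := by
  obtain ⟨e, he⟩ := h
  rw [geodAccel, ← he]
  simp

theorem geodAccel_eq_of_apply {q v u : E} (h : (G q).IsInvertible)
    (hu : ∀ w, G q u w = geodForm G q v w) : geodAccel G q v = u := by
  obtain ⟨e, he⟩ := h
  rw [geodAccel, ← ContinuousLinearMap.ext hu, ← he]
  simp

theorem geodForm_smul (q v : E) (t : ℝ) : geodForm G q (t • v) = t ^ 2 • geodForm G q v := by
  ext w
  simp only [geodForm_apply, map_smul, FunLike.coe_smul, Pi.smul_apply, smul_eq_mul]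
  ring

theorem geodAccel_smul (q v : E) (t : ℝ) : geodAccel G q (t • v) = t ^ 2 • geodAccel G q v := by
  rw [geodAccel, geodForm_smul, map_smul, geodAccel]

theorem contDiffOn_geodAccel [CompleteSpace E] {U : Set E} (hU : IsOpen U)
    (hG : ContDiffOn ℝ ∞ G U) (hinv : ∀ q ∈ U, (G q).IsInvertible) :
    ContDiffOn ℝ ∞ (fun z : E × E => geodAccel G z.1 z.2) (U ×ˢ univ) := by
  have hfst : MapsTo (Prod.fst : E × E → E) (U ×ˢ univ) U := fun z hz => hz.1
  have hD : ContDiffOn ℝ ∞ (fun z : E × E => fderiv ℝ G z.1) (U ×ˢ univ) :=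
    (hG.fderiv_of_isOpen hU (m := ∞) (by simp)).comp contDiff_fst.contDiffOn hfst
  have hI : ContDiffOn ℝ ∞ (fun z : E × E => (G z.1).inverse) (U ×ˢ univ) := by
    intro z hz
    have h1 := ((hinv z.1 hz.1).contDiffAt_map_inverse (n := ∞))
    have h2 := hG.comp (contDiff_fst (𝕜 := ℝ) (E := E) (F := E) (n := ∞)).contDiffOn hfst z hz
    exact h1.comp_contDiffWithinAt z h2
  have hsnd : ContDiffOn ℝ ∞ (fun z : E × E => z.2) (U ×ˢ univ) := contDiff_snd.contDiffOn
  refine hI.clm_apply ?_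
  let fl : (E →L[ℝ] E →L[ℝ] E →L[ℝ] ℝ) →L[ℝ] (E →L[ℝ] E →L[ℝ] E →L[ℝ] ℝ) :=
    (ContinuousLinearMap.flipₗᵢ ℝ E E (E →L[ℝ] ℝ)).toContinuousLinearEquiv
  let fl' : (E →L[ℝ] E →L[ℝ] ℝ) →L[ℝ] (E →L[ℝ] E →L[ℝ] ℝ) :=
    (ContinuousLinearMap.flipₗᵢ ℝ E E ℝ).toContinuousLinearEquiv
  have h1 : ContDiffOn ℝ ∞ (fun z : E × E => fl (fderiv ℝ G z.1)) (U ×ˢ univ) :=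
    fl.contDiff.comp_contDiffOn hD
  have h2 : ContDiffOn ℝ ∞ (fun z : E × E => fl' (fl (fderiv ℝ G z.1) z.2)) (U ×ˢ univ) :=
    fl'.contDiff.comp_contDiffOn (h1.clm_apply hsnd)
  exact ((h2.clm_apply hsnd).const_smul (1 / 2 : ℝ)).sub ((hD.clm_apply hsnd).clm_apply hsnd)

/-- The transformation law of the spray: if `σ` is an isometry from the metric `G` to the metric
`G'`, then it maps geodesics to geodesics. -/
theorem geodAccel_map {F : Type*} [NormedAddCommGroup F] [NormedSpace ℝ F]
    {G' : F → F →L[ℝ] F →L[ℝ] ℝ} {σ : E → F} {q : E} (v : E)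
    (hσ : ContDiffAt ℝ 2 σ q) (hsurj : Function.Surjective (fderiv ℝ σ q))
    (hpull : ∀ᶠ z in 𝓝 q, ∀ a b, G z a b = G' (σ z) (fderiv ℝ σ z a) (fderiv ℝ σ z b))
    (hG : DifferentiableAt ℝ G q) (hG' : DifferentiableAt ℝ G' (σ q))
    (hsymm : ∀ a b, G' (σ q) a b = G' (σ q) b a)
    (hinv : (G q).IsInvertible) (hinv' : (G' (σ q)).IsInvertible) :
    geodAccel G' (σ q) (fderiv ℝ σ q v) =
      fderiv ℝ (fderiv ℝ σ) q v v + fderiv ℝ σ q (geodAccel G q v) := by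
  have hσ1 : HasFDerivAt σ (fderiv ℝ σ q) q := (hσ.differentiableAt (by simp)).hasFDerivAt
  have hσ2 : HasFDerivAt (fderiv ℝ σ) (fderiv ℝ (fderiv ℝ σ) q) q :=
    ((hσ.fderiv_right (m := 1) (by norm_num)).differentiableAt (by simp)).hasFDerivAt
  have hsym2 : ∀ a b, fderiv ℝ (fderiv ℝ σ) q a b = fderiv ℝ (fderiv ℝ σ) q b a :=
    (hσ.isSymmSndFDerivAt (by simp)).eq
  -- the derivative of the pullback identity
  have hder : ∀ h a b : E, fderiv ℝ G q h a b =
      fderiv ℝ G' (σ q) (fderiv ℝ σ q h) (fderiv ℝ σ q a) (fderiv ℝ σ q b)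
        + G' (σ q) (fderiv ℝ (fderiv ℝ σ) q h a) (fderiv ℝ σ q b)
        + G' (σ q) (fderiv ℝ σ q a) (fderiv ℝ (fderiv ℝ σ) q h b) := by
    intro h a b
    have hl : HasFDerivAt (fun z => G z a b) _ q :=
      (hG.hasFDerivAt.clm_apply (hasFDerivAt_const a q)).clm_apply (hasFDerivAt_const b q)
    have hr : HasFDerivAt (fun z => G' (σ z) (fderiv ℝ σ z a) (fderiv ℝ σ z b)) _ q :=
      ((hG'.hasFDerivAt.comp q hσ1).clm_apply
        (hσ2.clm_apply (hasFDerivAt_const a q))).clm_apply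
        (hσ2.clm_apply (hasFDerivAt_const b q))
    have hr' := hr.congr_of_eventuallyEq (hpull.mono fun z hz => hz a b)
    have h3 := congrArg (fun L : E →L[ℝ] ℝ => L h) (hl.unique hr')
    simp at h3
    rw [h3]
    ring
  refine geodAccel_eq_of_apply hinv' fun w' => ?_
  obtain ⟨w, rfl⟩ := hsurj w'
  have hp := hpull.self_of_nhds
  have h1 : G' (σ q) (fderiv ℝ σ q (geodAccel G q v)) (fderiv ℝ σ q w) = geodForm G q v w := by
    rw [← hp, apply_geodAccel hinv]
  rw [map_add, add_apply, h1, geodForm_apply, geodForm_apply, hder, hder,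
    hsym2 w v, hsymm (fderiv ℝ σ q v) (fderiv ℝ (fderiv ℝ σ) q v w)]
  ring

end Geodesic

/-! ### Composition operators on spaces of continuous functions -/

section PostComp

universe u

-- one universe, since an induction below replaces `F` by `E →L[ℝ] F`
variable {K : Type*} [TopologicalSpace K] [CompactSpace K]
  {E F : Type u} [NormedAddCommGroup E] [NormedSpace ℝ E] [NormedAddCommGroup F] [NormedSpace ℝ F]

/-- The composition operator `y ↦ f ∘ y` on continuous functions, with the value `0` where `f ∘ y`
is not continuous. -/
def postComp (f : E → F) (y : C(K, E)) : C(K, F) := ContinuousMap.mkD (f ∘ y) 0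

omit [CompactSpace K] [NormedSpace ℝ E] [NormedSpace ℝ F] in
theorem postComp_apply {f : E → F} {U : Set E} (hf : ContinuousOn f U) {y : C(K, E)}
    (hy : ∀ t, y t ∈ U) (t : K) : postComp f y t = f (y t) :=
  ContinuousMap.mkD_apply_of_continuous (hf.comp_continuous y.continuous hy)

omit [NormedSpace ℝ E] in
theorem isOpen_setOf_forall_mem {U : Set E} (hU : IsOpen U) :
    IsOpen {y : C(K, E) | ∀ t, y t ∈ U} := by
  have h := ContinuousMap.isOpen_setOfPred_mapsTo (X := K) (Y := E) isCompact_univ hU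
  simpa [MapsTo] using h

omit [NormedSpace ℝ E] [NormedSpace ℝ F] in
/-- A function that is continuous on an open set is uniformly continuous along a compact curve in
that set. -/
theorem exists_forall_dist_lt {f : E → F} {U : Set E} (hU : IsOpen U) (hf : ContinuousOn f U)
    {y : C(K, E)} (hy : ∀ t, y t ∈ U) {ε : ℝ} (hε : 0 < ε) :
    ∃ δ > 0, ∀ t, ∀ z, dist z (y t) < δ → z ∈ U ∧ dist (f z) (f (y t)) < ε := by
  have hc : IsCompact (range y) := isCompact_range y.continuous
  have hsub : range y ⊆ U := range_subset_iff.2 hy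
  obtain ⟨δ₁, hδ₁, h1⟩ := hc.exists_thickening_subset_open hU hsub
  obtain ⟨δ₂, hδ₂, h2⟩ := Metric.mem_uniformity_dist.1
    (hc.uniformContinuousAt_of_continuousAt f
      (fun a ha => hf.continuousAt (hU.mem_nhds (hsub ha))) (Metric.dist_mem_uniformity hε))
  refine ⟨min δ₁ δ₂, lt_min hδ₁ hδ₂, fun t z hz => ⟨h1 ?_, ?_⟩⟩
  · exact Metric.mem_thickening_iff.2 ⟨y t, mem_range_self t, hz.trans_le (min_le_left _ _)⟩
  · rw [dist_comm]
    rw [dist_comm] at hz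
    exact h2 (hz.trans_le (min_le_right _ _)) (mem_range_self t)

omit [NormedSpace ℝ E] [NormedSpace ℝ F] in
theorem continuousOn_postComp {f : E → F} {U : Set E} (hU : IsOpen U) (hf : ContinuousOn f U) :
    ContinuousOn (postComp f) {y : C(K, E) | ∀ t, y t ∈ U} := by
  refine continuousOn_of_forall_continuousAt fun y hy => Metric.continuousAt_iff.2 fun ε hε => ?_
  obtain ⟨δ, hδ, h⟩ := exists_forall_dist_lt hU hf hy hε
  refine ⟨δ, hδ, fun {x} hx => (ContinuousMap.dist_lt_iff hε).2 fun t => ?_⟩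
  have hxt : ∀ t, dist (x t) (y t) < δ := fun t =>
    (ContinuousMap.dist_apply_le_dist t).trans_lt hx
  rw [postComp_apply hf hy, postComp_apply hf fun s => (h s _ (hxt s)).1]
  exact (h t _ (hxt t)).2

/-- Pointwise application of a continuous family of linear maps, as a linear map. -/
def pointwiseApply : C(K, E →L[ℝ] F) →L[ℝ] C(K, E) →L[ℝ] C(K, F) :=
  LinearMap.mkContinuous₂
    (LinearMap.mk₂ ℝ (fun (A : C(K, E →L[ℝ] F)) (h : C(K, E)) =>
        (⟨fun t => A t (h t), by fun_prop⟩ : C(K, F)))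
      (fun _ _ _ => by ext; simp) (fun _ _ _ => by ext; simp)
      (fun _ _ _ => by ext; simp) (fun _ _ _ => by ext; simp)) 1 (by
    intro A h
    rw [one_mul]
    refine (ContinuousMap.norm_le _ (by positivity)).2 fun t => ?_
    exact (ContinuousLinearMap.le_opNorm _ _).trans
      (mul_le_mul (A.norm_coe_le_norm t) (h.norm_coe_le_norm t) (norm_nonneg _) (norm_nonneg _)))

theorem pointwiseApply_apply (A : C(K, E →L[ℝ] F)) (h : C(K, E)) (t : K) :
    pointwiseApply A h t = A t (h t) := rfl

theorem hasFDerivAt_postComp {f : E → F} {U : Set E} (hU : IsOpen U) (hf : DifferentiableOn ℝ f U)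
    (hf' : ContinuousOn (fderiv ℝ f) U) {y : C(K, E)} (hy : ∀ t, y t ∈ U) :
    HasFDerivAt (postComp f) (pointwiseApply (postComp (fderiv ℝ f) y)) y := by
  rw [hasFDerivAt_iff_isLittleO, Asymptotics.isLittleO_iff]
  intro c hc
  obtain ⟨δ, hδ, h⟩ := exists_forall_dist_lt hU hf' hy hc
  filter_upwards [Metric.ball_mem_nhds y hδ] with x hx
  have hxt : ∀ t, dist (x t) (y t) < δ := fun t =>
    (ContinuousMap.dist_apply_le_dist t).trans_lt hx
  refine (ContinuousMap.norm_le _ (by positivity)).2 fun t => ?_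
  simp only [ContinuousMap.sub_apply, pointwiseApply_apply]
  rw [postComp_apply hf.continuousOn hy, postComp_apply hf' hy,
    postComp_apply hf.continuousOn fun s => (h s _ (hxt s)).1]
  refine ((convex_ball (y t) δ).norm_image_sub_le_of_norm_fderiv_le' (𝕜 := ℝ) (C := c)
    (fun z hz => hf.differentiableAt (hU.mem_nhds (h t z hz).1)) (fun z hz => ?_)
    (Metric.mem_ball_self hδ) (hxt t)).trans ?_
  · rw [← dist_eq_norm]
    exact (h t z hz).2.le
  · exact mul_le_mul_of_nonneg_left ((x - y).norm_coe_le_norm t) hc.le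

theorem contDiffOn_postComp_nat (n : ℕ) : ∀ {F : Type u} [NormedAddCommGroup F] [NormedSpace ℝ F]
    {f : E → F} {U : Set E} (_ : IsOpen U) (_ : ContDiffOn ℝ n f U),
    ContDiffOn ℝ n (postComp f) {y : C(K, E) | ∀ t, y t ∈ U} := by
  induction n with
  | zero =>
    intro F _ _ f U hU hf
    simp only [Nat.cast_zero, contDiffOn_zero] at hf ⊢
    exact continuousOn_postComp hU hf
  | succ n ih =>
    intro F _ _ f U hU hf
    have ho := isOpen_setOf_forall_mem (K := K) hU
    rw [Nat.cast_succ] at hf ⊢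
    rw [contDiffOn_succ_iff_fderiv_of_isOpen hU] at hf
    rw [contDiffOn_succ_iff_fderiv_of_isOpen ho]
    have hder : ∀ y ∈ {y : C(K, E) | ∀ t, y t ∈ U},
        HasFDerivAt (postComp f) (pointwiseApply (postComp (fderiv ℝ f) y)) y := fun y hy =>
      hasFDerivAt_postComp hU hf.1 hf.2.2.continuousOn hy
    refine ⟨fun y hy => (hder y hy).differentiableAt.differentiableWithinAt,
      fun h => absurd h (by simp), ?_⟩
    have h1 : ContDiffOn ℝ n (fun y => pointwiseApply (postComp (fderiv ℝ f) y))
        {y : C(K, E) | ∀ t, y t ∈ U} :=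
      (pointwiseApply (K := K) (E := E) (F := F)).contDiff.comp_contDiffOn (ih hU hf.2.2)
    exact h1.congr fun y hy => (hder y hy).fderiv

theorem contDiffOn_postComp {f : E → F} {U : Set E} (hU : IsOpen U) (hf : ContDiffOn ℝ ∞ f U) :
    ContDiffOn ℝ ∞ (postComp f) {y : C(K, E) | ∀ t, y t ∈ U} :=
  contDiffOn_infty.2 fun n => contDiffOn_postComp_nat n hU (contDiffOn_infty.1 hf n)

end PostComp

/-! ### Second order differential equations that are quadratic in the velocity -/

section SecondOrder

universe u

variable {E : Type u} [NormedAddCommGroup E] [NormedSpace ℝ E]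

/-- The time interval `[-1, 2]`, on which solutions are constructed. -/
abbrev TimeInterval : Type := Icc (-1 : ℝ) 2

/-- The extension of a continuous function on `[-1, 2]` to the real line, constant outside. -/
def extendTime (a : C(TimeInterval, E)) : ℝ → E := IccExtend (by norm_num) a

omit [NormedSpace ℝ E] in
theorem continuous_extendTime (a : C(TimeInterval, E)) : Continuous (extendTime a) :=
  a.continuous.Icc_extend'

omit [NormedSpace ℝ E] in
theorem extendTime_of_mem (a : C(TimeInterval, E)) {t : ℝ} (ht : t ∈ Icc (-1 : ℝ) 2) :
    extendTime a t = a ⟨t, ht⟩ := IccExtend_of_mem _ _ ht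

omit [NormedSpace ℝ E] in
theorem norm_extendTime_le (a : C(TimeInterval, E)) (t : ℝ) : ‖extendTime a t‖ ≤ ‖a‖ :=
  a.norm_coe_le_norm _

/-- The primitive that vanishes at `0`, as an operator on continuous functions on `[-1, 2]`. -/
def primitiveTime : C(TimeInterval, E) →L[ℝ] C(TimeInterval, E) :=
  LinearMap.mkContinuous
    { toFun := fun a => ⟨fun t => ∫ s in (0 : ℝ)..t, extendTime a s,
        (intervalIntegral.continuous_primitive
          (fun _ _ => (continuous_extendTime a).intervalIntegrable _ _) 0).comp
          continuous_subtype_val⟩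
      map_add' := fun a b => by
        ext t
        exact intervalIntegral.integral_add ((continuous_extendTime a).intervalIntegrable _ _)
          ((continuous_extendTime b).intervalIntegrable _ _)
      map_smul' := fun c a => by
        ext t
        exact intervalIntegral.integral_smul c _ } 2 (by
    intro a
    refine (ContinuousMap.norm_le _ (by positivity)).2 fun t => ?_
    refine (intervalIntegral.norm_integral_le_of_norm_le_const
      fun s _ => norm_extendTime_le a s).trans ?_
    have h : |(t : ℝ) - 0| ≤ 2 := by
      rw [sub_zero, abs_le]
      exact ⟨by linarith [t.2.1], t.2.2⟩
    rw [mul_comm]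
    gcongr)

theorem primitiveTime_apply (a : C(TimeInterval, E)) (t : TimeInterval) :
    primitiveTime a t = ∫ s in (0 : ℝ)..t, extendTime a s := rfl

/-- The linear function `t ↦ t • v` on `[-1, 2]`. -/
def linearTime : E →L[ℝ] C(TimeInterval, E) :=
  LinearMap.mkContinuous
    { toFun := fun v => ⟨fun t => (t : ℝ) • v, by fun_prop⟩
      map_add' := fun v w => by ext; simp
      map_smul' := fun c v => by ext t; exact smul_comm _ _ _ } 2 (by
    intro v
    refine (ContinuousMap.norm_le _ (by positivity)).2 fun t => ?_
    have h : |(t : ℝ)| ≤ 2 := abs_le.2 ⟨by linarith [t.2.1], t.2.2⟩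
    simp only [LinearMap.coe_mk, AddHom.coe_mk, ContinuousMap.coe_mk, norm_smul, Real.norm_eq_abs]
    gcongr)

/-- The position of a motion on `[-1, 2]` with given initial position and velocity `p.1` and
acceleration `p.2`. -/
def motionPos : (E × E) × C(TimeInterval, E) →L[ℝ] C(TimeInterval, E) :=
  (ContinuousLinearMap.const ℝ TimeInterval).comp
      ((ContinuousLinearMap.fst ℝ E E).comp (ContinuousLinearMap.fst ℝ _ _))
    + linearTime.comp ((ContinuousLinearMap.snd ℝ E E).comp (ContinuousLinearMap.fst ℝ _ _))
    + (primitiveTime.comp primitiveTime).comp (ContinuousLinearMap.snd ℝ _ _)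

/-- The velocity of a motion on `[-1, 2]` with given initial position and velocity `p.1` and
acceleration `p.2`. -/
def motionVel : (E × E) × C(TimeInterval, E) →L[ℝ] C(TimeInterval, E) :=
  (ContinuousLinearMap.const ℝ TimeInterval).comp
      ((ContinuousLinearMap.snd ℝ E E).comp (ContinuousLinearMap.fst ℝ _ _))
    + primitiveTime.comp (ContinuousLinearMap.snd ℝ _ _)

theorem motionPos_apply (z : E × E) (a : C(TimeInterval, E)) (t : TimeInterval) :
    motionPos (z, a) t = z.1 + (t : ℝ) • z.2 + primitiveTime (primitiveTime a) t := rfl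

theorem motionVel_apply (z : E × E) (a : C(TimeInterval, E)) (t : TimeInterval) :
    motionVel (z, a) t = z.2 + primitiveTime a t := rfl

/-- Position and velocity of a motion on `[-1, 2]` with given initial position and velocity `p.1`
and acceleration `p.2`. -/
def motion : (E × E) × C(TimeInterval, E) →L[ℝ] C(TimeInterval, E × E) :=
  ((ContinuousLinearMap.inl ℝ E E).compLeftContinuous ℝ TimeInterval).comp motionPos
    + ((ContinuousLinearMap.inr ℝ E E).compLeftContinuous ℝ TimeInterval).comp motionVel

theorem motion_apply (p : (E × E) × C(TimeInterval, E)) (t : TimeInterval) :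
    motion p t = (motionPos p t, motionVel p t) := by
  have h : motion p t = (motionPos p t, 0) + (0, motionVel p t) := rfl
  rw [h]
  simp

theorem hasDerivAt_extendTime_motion [CompleteSpace E] (p : (E × E) × C(TimeInterval, E)) {t : ℝ}
    (ht : t ∈ Ioo (-1 : ℝ) 2) :
    HasDerivAt (extendTime (motion p)) (motionVel p ⟨t, Ioo_subset_Icc_self ht⟩,
      p.2 ⟨t, Ioo_subset_Icc_self ht⟩) t := by
  obtain ⟨z, a⟩ := p
  have hI : ∀ b : C(TimeInterval, E), HasDerivAt (fun t => ∫ s in (0 : ℝ)..t, extendTime b s)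
      (b ⟨t, Ioo_subset_Icc_self ht⟩) t := by
    intro b
    rw [← extendTime_of_mem b]
    exact intervalIntegral.integral_hasDerivAt_right
      ((continuous_extendTime b).intervalIntegrable _ _)
      ((continuous_extendTime b).stronglyMeasurableAtFilter _ _)
      (continuous_extendTime b).continuousAt
  have h1 : HasDerivAt (fun t : ℝ => (z.1 + t • z.2 + ∫ s in (0 : ℝ)..t,
      extendTime (primitiveTime a) s, z.2 + ∫ s in (0 : ℝ)..t, extendTime a s))
      (motionVel (z, a) ⟨t, Ioo_subset_Icc_self ht⟩, a ⟨t, Ioo_subset_Icc_self ht⟩) t := by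
    refine HasDerivAt.prodMk ?_ ((hI a).const_add _)
    have := (((hasDerivAt_id t).smul_const z.2).const_add z.1).add (hI (primitiveTime a))
    rw [one_smul] at this
    exact this
  refine h1.congr_of_eventuallyEq ?_
  filter_upwards [isOpen_Ioo.mem_nhds ht] with s hs
  rw [extendTime_of_mem _ (Ioo_subset_Icc_self hs), motion_apply]
  rfl

theorem extendTime_motion_zero (p : (E × E) × C(TimeInterval, E)) :
    extendTime (motion p) 0 = p.1 := by
  rw [extendTime_of_mem _ (by norm_num), motion_apply]
  obtain ⟨z, a⟩ := p
  simp [motionPos_apply, motionVel_apply, primitiveTime_apply]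

/-- The time one map of the second order equation `x'' = A(x, x')`, with `A` smooth and of order two
in the velocity, is defined and smooth for initial conditions near a rest point, and its derivative
there is the one of the motion without acceleration.

The unknown is the acceleration `a`, in the space of continuous functions on `[-1, 2]`; it solves
`a = A(x, x')`, whose linearization at `a = 0` is the identity since `A` has order two in the
velocity. -/
theorem exists_timeOneMap [CompleteSpace E] {A : E × E → E} {U : Set E} (hU : IsOpen U)
    (hA : ContDiffOn ℝ ∞ A (U ×ˢ univ))
    {q₀ : E} (hq₀ : q₀ ∈ U) (hA0 : A (q₀, 0) = 0) (hA' : fderiv ℝ A (q₀, 0) = 0) :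
    ∃ (W : Set (E × E)) (e : E × E → E), IsOpen W ∧ (q₀, 0) ∈ W ∧ ContDiffOn ℝ ∞ e W ∧
      HasFDerivAt e (ContinuousLinearMap.fst ℝ E E + ContinuousLinearMap.snd ℝ E E) (q₀, 0) ∧
      e (q₀, 0) = q₀ ∧
      ∀ z ∈ W, ∃ c : ℝ → E × E, c 0 = z ∧ (c 1).1 = e z ∧
        ∀ t ∈ Ioo (-1 : ℝ) 2, (c t).1 ∈ U ∧ HasDerivAt c ((c t).2, A (c t)) t := by
  have hUo : IsOpen (U ×ˢ (univ : Set E)) := hU.prod isOpen_univ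
  set S : Set ((E × E) × C(TimeInterval, E)) := {p | ∀ t, motion p t ∈ U ×ˢ (univ : Set E)}
    with hS
  have hSo : IsOpen S := (isOpen_setOf_forall_mem hUo).preimage motion.continuous
  set Ψ : (E × E) × C(TimeInterval, E) → (E × E) × C(TimeInterval, E) :=
    fun p => (p.1, p.2 - postComp A (motion p)) with hΨ
  have hΨS : ContDiffOn ℝ ∞ Ψ S :=
    contDiff_fst.contDiffOn.prodMk (contDiff_snd.contDiffOn.sub
      ((contDiffOn_postComp hUo hA).comp
      (ContinuousLinearMap.contDiff (motion (E := E))).contDiffOn fun p hp => hp))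
  set p₀ : (E × E) × C(TimeInterval, E) := ((q₀, 0), 0) with hp₀
  have hmot : ∀ t, motion p₀ t = (q₀, 0) := by
    intro t
    simp [motion_apply, hp₀, motionPos_apply, motionVel_apply]
  have hp₀S : p₀ ∈ S := fun t => by rw [hmot]; exact ⟨hq₀, mem_univ _⟩
  have hpc0 : postComp A (motion p₀) = 0 := by
    ext t
    rw [postComp_apply hA.continuousOn hp₀S, hmot, hA0]
    rfl
  have hΨ0 : Ψ p₀ = p₀ := by
    show (p₀.1, p₀.2 - postComp A (motion p₀)) = p₀
    rw [hpc0, sub_zero]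
  have hpcd : HasFDerivAt (fun p => postComp A (motion p))
      (0 : (E × E) × C(TimeInterval, E) →L[ℝ] C(TimeInterval, E)) p₀ := by
    have h1 := hasFDerivAt_postComp hUo (hA.differentiableOn (by simp))
      (hA.continuousOn_fderiv_of_isOpen hUo (by simp)) hp₀S
    have h2 : postComp (fderiv ℝ A) (motion p₀) = 0 := by
      ext1 t
      rw [postComp_apply (hA.continuousOn_fderiv_of_isOpen hUo (by simp)) hp₀S, hmot, hA']
      rfl
    rw [h2, map_zero] at h1
    have h3 := h1.comp p₀ (ContinuousLinearMap.hasFDerivAt (motion (E := E)))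
    rwa [ContinuousLinearMap.zero_comp] at h3
  have hΨd : HasFDerivAt Ψ ((ContinuousLinearEquiv.refl ℝ ((E × E) × C(TimeInterval, E)) :
      (E × E) × C(TimeInterval, E) →L[ℝ] (E × E) × C(TimeInterval, E))) p₀ := by
    have h1 := (ContinuousLinearMap.fst ℝ (E × E) C(TimeInterval, E)).hasFDerivAt (x := p₀)
    have h2 := (ContinuousLinearMap.snd ℝ (E × E) C(TimeInterval, E)).hasFDerivAt (x := p₀)
    refine (h1.prodMk (h2.sub hpcd)).congr_fderiv ?_
    ext <;> simp
  obtain ⟨Φ, hpΦ, hΦS, hΦΨ, hΦsymm⟩ :=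
    exists_openPartialHomeomorph_contDiffOn_symm hSo hp₀S hΨS _ hΨd
  have hΦp : Φ p₀ = p₀ := by rw [hΦΨ, hΨ0]
  have hp₀t : p₀ ∈ Φ.target := hΦp ▸ Φ.map_source hpΦ
  have hsymm0 : Φ.symm p₀ = p₀ := by
    conv_lhs => rw [← hΦp]
    exact Φ.left_inv hpΦ
  let ι : E × E →L[ℝ] (E × E) × C(TimeInterval, E) := ContinuousLinearMap.inl ℝ _ _
  let ev : (E × E) × C(TimeInterval, E) →L[ℝ] E :=
    (ContinuousLinearMap.fst ℝ E E).comp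
      ((ContinuousMap.evalCLM ℝ (⟨1, by norm_num⟩ : TimeInterval)).comp motion)
  have hev : ∀ p, ev p = (extendTime (motion p) 1).1 := fun p => by
    rw [extendTime_of_mem _ (by norm_num)]
    rfl
  have hmaps : MapsTo ι (ι ⁻¹' Φ.target) Φ.target := fun z hz => hz
  refine ⟨ι ⁻¹' Φ.target, fun z => ev (Φ.symm (ι z)), Φ.open_target.preimage ι.continuous, hp₀t,
    ev.contDiff.comp_contDiffOn (hΦsymm.comp ι.contDiff.contDiffOn hmaps), ?_, ?_, ?_⟩
  · have h1 : HasFDerivAt Φ.symm ((ContinuousLinearEquiv.refl ℝ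
        ((E × E) × C(TimeInterval, E)) : (E × E) × C(TimeInterval, E) →L[ℝ]
        (E × E) × C(TimeInterval, E))) (ι (q₀, 0)) := by
      refine Φ.hasFDerivAt_symm hp₀t
        (f' := ContinuousLinearEquiv.refl ℝ ((E × E) × C(TimeInterval, E))) ?_
      have : Φ.symm (ι (q₀, 0)) = p₀ := hsymm0
      rw [this]
      exact hΨd.congr_of_eventuallyEq (Eventually.of_forall hΦΨ)
    have h2 := ev.hasFDerivAt.comp (q₀, 0) (h1.comp (q₀, 0) ι.hasFDerivAt)
    refine h2.congr_fderiv ?_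
    ext v <;>
      simp [ι, hev, extendTime_of_mem _ (show (1 : ℝ) ∈ Icc (-1 : ℝ) 2 by norm_num), motion_apply,
        motionPos_apply]
  · show ev (Φ.symm p₀) = q₀
    rw [hsymm0, hev, extendTime_of_mem _ (by norm_num), hmot]
  · intro z hz
    set p := Φ.symm (ι z) with hp
    have hpS : p ∈ S := hΦS (Φ.map_target hz)
    have hΨp : Ψ p = (z, 0) := by
      rw [← hΦΨ, hp, Φ.right_inv hz]
      rfl
    have hp1 : p.1 = z := congrArg Prod.fst hΨp
    have hp2 : p.2 = postComp A (motion p) := sub_eq_zero.1 (congrArg Prod.snd hΨp)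
    refine ⟨extendTime (motion p), (extendTime_motion_zero p).trans hp1, (hev p).symm,
      fun t ht => ?_⟩
    have hmem := Ioo_subset_Icc_self ht
    rw [extendTime_of_mem _ hmem]
    refine ⟨(hpS _).1, ?_⟩
    have h := hasDerivAt_extendTime_motion p ht
    rw [hp2, postComp_apply hA.continuousOn hpS] at h
    rw [motion_apply]
    rw [motion_apply] at h
    exact h

end SecondOrder

/-! ### The metric in a chart -/

section ChartMetric

variable {E : Type*} [NormedAddCommGroup E] [InnerProductSpace ℝ E]
  {X : Type*} [TopologicalSpace X] [ChartedSpace E X]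

/-- The derivative of a chart at a point, as an endomorphism of the model space. -/
def chartDeriv (φ : OpenPartialHomeomorph X E) (x : X) : E →L[ℝ] E :=
  mfderiv 𝓘(ℝ, E) 𝓘(ℝ, E) φ x

/-- The derivative of the inverse of a chart at a point of the model space, as an endomorphism of
the model space. -/
def chartSymmDeriv (φ : OpenPartialHomeomorph X E) (q : E) : E →L[ℝ] E :=
  mfderiv 𝓘(ℝ, E) 𝓘(ℝ, E) φ.symm q

/-- The derivative of a self-map of the manifold, as an endomorphism of the model space. -/
def selfDeriv (f : X → X) (x : X) : E →L[ℝ] E := mfderiv 𝓘(ℝ, E) 𝓘(ℝ, E) f x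

variable [IsManifold 𝓘(ℝ, E) ∞ X]

/-- The metric at a point, as a bilinear form on the model space. -/
def metricAt (g : StrongMetric E X) (x : X) : E →L[ℝ] E →L[ℝ] ℝ := g.inner x

/-- The coordinate expression of the metric in a chart: the pullback of the metric under the inverse
of the chart. -/
def chartMetric (g : StrongMetric E X) (φ : OpenPartialHomeomorph X E) (q : E) :
    E →L[ℝ] E →L[ℝ] ℝ :=
  (metricAt g (φ.symm q)).bilinearComp (chartSymmDeriv φ q) (chartSymmDeriv φ q)

theorem chartMetric_apply (g : StrongMetric E X) (φ : OpenPartialHomeomorph X E) (q a b : E) :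
    chartMetric g φ q a b =
      metricAt g (φ.symm q) (chartSymmDeriv φ q a) (chartSymmDeriv φ q b) := rfl

theorem metricAt_symm (g : StrongMetric E X) (x : X) (a b : E) :
    metricAt g x a b = metricAt g x b a := g.symm x a b

theorem metricAt_pos (g : StrongMetric E X) (x : X) {a : E} (ha : a ≠ 0) : 0 < metricAt g x a a :=
  g.pos x a ha

theorem chartMetric_symm (g : StrongMetric E X) (φ : OpenPartialHomeomorph X E) (q a b : E) :
    chartMetric g φ q a b = chartMetric g φ q b a := metricAt_symm g _ _ _

local notation "Atlas∞" => IsManifold.maximalAtlas 𝓘(ℝ, E) ∞ X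

theorem chartAt_mem_maximalAtlas (x : X) : chartAt E x ∈ Atlas∞ :=
  IsManifold.chart_mem_maximalAtlas x

variable {φ χ : OpenPartialHomeomorph X E}

omit [IsManifold 𝓘(ℝ, E) ∞ X] in
theorem mdifferentiable_of_mem_maximalAtlas (hφ : φ ∈ Atlas∞) :
    φ.MDifferentiable 𝓘(ℝ, E) 𝓘(ℝ, E) :=
  ⟨(contMDiffOn_of_mem_maximalAtlas hφ).mdifferentiableOn (by simp),
    (contMDiffOn_symm_of_mem_maximalAtlas hφ).mdifferentiableOn (by simp)⟩

omit [IsManifold 𝓘(ℝ, E) ∞ X] in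
theorem chartSymmDeriv_chartDeriv (hφ : φ ∈ Atlas∞) {x : X} (hx : x ∈ φ.source) (v : E) :
    chartSymmDeriv φ (φ x) (chartDeriv φ x v) = v :=
  congrArg (fun L : E →L[ℝ] E => L v)
    ((mdifferentiable_of_mem_maximalAtlas hφ).symm_comp_deriv hx)

omit [IsManifold 𝓘(ℝ, E) ∞ X] in
theorem chartDeriv_chartSymmDeriv (hφ : φ ∈ Atlas∞) {q : E} (hq : q ∈ φ.target) (v : E) :
    chartDeriv φ (φ.symm q) (chartSymmDeriv φ q v) = v :=
  congrArg (fun L : E →L[ℝ] E => L v)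
    ((mdifferentiable_of_mem_maximalAtlas hφ).comp_symm_deriv hq)

theorem metricAt_eq_chartMetric (g : StrongMetric E X) (hφ : φ ∈ Atlas∞) {x : X}
    (hx : x ∈ φ.source) (a b : E) :
    metricAt g x a b = chartMetric g φ (φ x) (chartDeriv φ x a) (chartDeriv φ x b) := by
  rw [chartMetric_apply, chartSymmDeriv_chartDeriv hφ hx, chartSymmDeriv_chartDeriv hφ hx,
    φ.left_inv hx]

theorem chartMetric_pos (g : StrongMetric E X) (hφ : φ ∈ Atlas∞) {q : E} (hq : q ∈ φ.target)
    {a : E} (ha : a ≠ 0) : 0 < chartMetric g φ q a a := by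
  refine metricAt_pos g _ fun h => ha ?_
  rw [← chartDeriv_chartSymmDeriv hφ hq a]
  exact (congrArg (chartDeriv φ (φ.symm q)) h).trans (map_zero _)

theorem isInvertible_of_pos_of_riesz [CompleteSpace E] {B : E →L[ℝ] E →L[ℝ] ℝ}
    (hpos : ∀ a, a ≠ 0 → 0 < B a a) (hriesz : ∀ L : E →L[ℝ] ℝ, ∃ u, ∀ w, B u w = L w) :
    B.IsInvertible := by
  refine ⟨ContinuousLinearEquiv.ofBijective B ?_ ?_, rfl⟩
  · refine LinearMap.ker_eq_bot'.2 fun a ha => by_contra fun h0 => ?_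
    have h1 := hpos a h0
    have h2 : B a = 0 := ha
    rw [h2] at h1
    exact lt_irrefl _ h1
  · refine LinearMap.range_eq_top.2 fun L => ?_
    obtain ⟨u, hu⟩ := hriesz L
    exact ⟨u, ContinuousLinearMap.ext hu⟩

theorem isInvertible_chartMetric [CompleteSpace E] (g : StrongMetric E X) (hφ : φ ∈ Atlas∞) {q : E}
    (hq : q ∈ φ.target) : (chartMetric g φ q).IsInvertible := by
  refine isInvertible_of_pos_of_riesz (fun a ha => chartMetric_pos g hφ hq ha) fun L => ?_
  obtain ⟨u, hu⟩ := g.exists_riesz (φ.symm q) (L.comp (chartDeriv φ (φ.symm q)))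
  refine ⟨chartDeriv φ (φ.symm q) u, fun w => ?_⟩
  have hq' := φ.map_target hq
  have h1 := hu (chartSymmDeriv φ q w)
  rw [ContinuousLinearMap.comp_apply, chartDeriv_chartSymmDeriv hφ hq] at h1
  rw [← h1, chartMetric_apply]
  have h2 := chartSymmDeriv_chartDeriv hφ hq' u
  rw [φ.right_inv hq] at h2
  rw [h2]
  rfl

/-- The coordinate expression of a self-map of the manifold. -/
def coordMap (φ χ : OpenPartialHomeomorph X E) (f : X → X) : E → E := φ ∘ f ∘ χ.symm

/-- The set on which the coordinate expression of a self-map is meaningful. -/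
def coordDomain (φ χ : OpenPartialHomeomorph X E) (f : X → X) : Set E :=
  χ.target ∩ χ.symm ⁻¹' (f ⁻¹' φ.source)

omit [InnerProductSpace ℝ E] [ChartedSpace E X] [IsManifold 𝓘(ℝ, E) ∞ X] in
theorem isOpen_coordDomain {f : X → X} (hf : Continuous f) : IsOpen (coordDomain φ χ f) :=
  χ.symm.continuousOn.isOpen_inter_preimage χ.open_target (φ.open_source.preimage hf)

omit [IsManifold 𝓘(ℝ, E) ∞ X] in
theorem contDiffOn_coordMap (hφ : φ ∈ Atlas∞) (hχ : χ ∈ Atlas∞) {f : X → X}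
    (hf : ContMDiff 𝓘(ℝ, E) 𝓘(ℝ, E) ∞ f) :
    ContDiffOn ℝ ∞ (coordMap φ χ f) (coordDomain φ χ f) := by
  rw [← contMDiffOn_iff_contDiffOn]
  refine (contMDiffOn_of_mem_maximalAtlas hφ).comp (t := φ.source) (hf.comp_contMDiffOn
    ((contMDiffOn_symm_of_mem_maximalAtlas hχ).mono inter_subset_left)) fun q hq => hq.2

omit [IsManifold 𝓘(ℝ, E) ∞ X] in
theorem fderiv_coordMap (hφ : φ ∈ Atlas∞) (hχ : χ ∈ Atlas∞) {f : X → X}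
    (hf : ContMDiff 𝓘(ℝ, E) 𝓘(ℝ, E) ∞ f) {q : E} (hq : q ∈ coordDomain φ χ f) (v : E) :
    fderiv ℝ (coordMap φ χ f) q v =
      chartDeriv φ (f (χ.symm q)) (selfDeriv f (χ.symm q) (chartSymmDeriv χ q v)) := by
  have h1 : MDifferentiableAt 𝓘(ℝ, E) 𝓘(ℝ, E) χ.symm q :=
    (mdifferentiable_of_mem_maximalAtlas hχ).mdifferentiableAt_symm hq.1
  have h2 : MDifferentiableAt 𝓘(ℝ, E) 𝓘(ℝ, E) f (χ.symm q) := hf.mdifferentiableAt (by simp)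
  have h3 : MDifferentiableAt 𝓘(ℝ, E) 𝓘(ℝ, E) φ (f (χ.symm q)) :=
    (mdifferentiable_of_mem_maximalAtlas hφ).mdifferentiableAt hq.2
  have h4 := h3.hasMFDerivAt.comp q (h2.hasMFDerivAt.comp q h1.hasMFDerivAt)
  rw [← mfderiv_eq_fderiv]
  exact congrArg (fun L : E →L[ℝ] E => L v) h4.mfderiv

/-- A local isometry pulls the coordinate expression of the metric back to itself. -/
theorem chartMetric_pullback (g : StrongMetric E X) (hφ : φ ∈ Atlas∞) (hχ : χ ∈ Atlas∞) {f : X → X}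
    (hf : ContMDiff 𝓘(ℝ, E) 𝓘(ℝ, E) ∞ f)
    (hiso : ∀ x a b, metricAt g (f x) (selfDeriv f x a) (selfDeriv f x b) = metricAt g x a b)
    {q : E} (hq : q ∈ coordDomain φ χ f) (a b : E) :
    chartMetric g χ q a b = chartMetric g φ (coordMap φ χ f q)
      (fderiv ℝ (coordMap φ χ f) q a) (fderiv ℝ (coordMap φ χ f) q b) := by
  rw [fderiv_coordMap hφ hχ hf hq, fderiv_coordMap hφ hχ hf hq, chartMetric_apply, ← hiso]
  exact metricAt_eq_chartMetric g hφ hq.2 _ _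

omit [IsManifold 𝓘(ℝ, E) ∞ X] in
theorem selfDeriv_id (x : X) : selfDeriv (id : X → X) x = ContinuousLinearMap.id ℝ E := mfderiv_id

/-- The metric in a chart is smooth. -/
theorem contDiffOn_chartMetric (g : StrongMetric E X) (hφ : φ ∈ Atlas∞) :
    ContDiffOn ℝ ∞ (chartMetric g φ) φ.target := by
  intro q₁ hq₁
  refine ContDiffAt.contDiffWithinAt ?_
  set x₀ := φ.symm q₁ with hx₀
  set χ := chartAt E x₀ with hχ
  have hχm : χ ∈ Atlas∞ := chartAt_mem_maximalAtlas x₀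
  let B : X → E →L[ℝ] E →L[ℝ] ℝ := fun x =>
    ContinuousLinearMap.inCoordinates E (TangentSpace 𝓘(ℝ, E)) (E →L[ℝ] ℝ)
      (fun x : X => TangentSpace 𝓘(ℝ, E) x →L[ℝ] ℝ) x₀ x x₀ x (g.inner x)
  have hB : ContMDiffAt 𝓘(ℝ, E) 𝓘(ℝ, E →L[ℝ] E →L[ℝ] ℝ) ∞ B x₀ :=
    (contMDiffAt_hom_bundle _).1 (g.contMDiff x₀) |>.2
  have hBapp : ∀ x ∈ χ.source, ∀ v w, B x v w =
      metricAt g x (chartSymmDeriv χ (χ x) v) (chartSymmDeriv χ (χ x) w) := by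
    intro x hx v w
    have hL : ∀ u : E, (trivializationAt E (TangentSpace 𝓘(ℝ, E)) x₀).symm x u =
        chartSymmDeriv χ (χ x) u := by
      intro u
      have h1 := TangentBundle.symmL_trivializationAt (I := 𝓘(ℝ, E)) hx
      rw [ModelWithCorners.range_eq_univ, mfderivWithin_univ] at h1
      exact ((trivializationAt E (TangentSpace 𝓘(ℝ, E)) x₀).symmL_apply (R := ℝ) hx u).symm.trans
        (congrArg (fun L : E →L[ℝ] E => L u) h1)
    have h := inCoordinates_apply_eq₂ (E₁ := fun x : X => TangentSpace 𝓘(ℝ, E) x)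
      (E₂ := fun x : X => TangentSpace 𝓘(ℝ, E) x) (E₃ := Bundle.Trivial X ℝ) (F₁ := E) (F₂ := E)
      (F₃ := ℝ) (𝕜 := ℝ) (x₀ := x₀) (x := x) (ϕ := g.inner x) (v := v) (w := w) hx hx (mem_univ _)
    rw [hL, hL] at h
    refine h.trans ?_
    simp
    rfl
  have hid : ContMDiff 𝓘(ℝ, E) 𝓘(ℝ, E) ∞ (id : X → X) := contMDiff_id
  have hq₁d : q₁ ∈ coordDomain χ φ id := ⟨hq₁, mem_chart_source E x₀⟩
  have hdo : coordDomain χ φ id ∈ 𝓝 q₁ := (isOpen_coordDomain continuous_id).mem_nhds hq₁d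
  have hτ : ContDiffAt ℝ ∞ (fderiv ℝ (coordMap χ φ id)) q₁ :=
    ((contDiffOn_coordMap hχm hφ hid).contDiffAt hdo).fderiv_right (by simp)
  have hBq : ContDiffAt ℝ ∞ (fun q => B (φ.symm q)) q₁ := by
    rw [← contMDiffAt_iff_contDiffAt]
    exact ContMDiffAt.comp q₁ hB
      ((contMDiffOn_symm_of_mem_maximalAtlas hφ).contMDiffAt (φ.open_target.mem_nhds hq₁))
  let fl : (E →L[ℝ] E →L[ℝ] ℝ) →L[ℝ] (E →L[ℝ] E →L[ℝ] ℝ) :=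
    (ContinuousLinearMap.flipₗᵢ ℝ E E ℝ).toContinuousLinearEquiv
  have hfin : ContDiffAt ℝ ∞ (fun q => fl ((fl ((B (φ.symm q)).comp
      (fderiv ℝ (coordMap χ φ id) q))).comp (fderiv ℝ (coordMap χ φ id) q))) q₁ :=
    fl.contDiff.contDiffAt.comp q₁
      ((fl.contDiff.contDiffAt.comp q₁ (hBq.clm_comp hτ)).clm_comp hτ)
  refine hfin.congr_of_eventuallyEq ?_
  filter_upwards [hdo] with q hq
  refine ContinuousLinearMap.ext fun a => ContinuousLinearMap.ext fun b => ?_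
  show _ = B (φ.symm q) (fderiv ℝ (coordMap χ φ id) q a) (fderiv ℝ (coordMap χ φ id) q b)
  have hx : φ.symm q ∈ χ.source := hq.2
  rw [hBapp _ hx, fderiv_coordMap hχm hφ hid hq, fderiv_coordMap hχm hφ hid hq, selfDeriv_id]
  simp only [ContinuousLinearMap.id_apply, id_eq]
  rw [chartSymmDeriv_chartDeriv hχm hx, chartSymmDeriv_chartDeriv hχm hx]
  rfl

end ChartMetric

/-! ### The charts of the tangent bundle and the spray in these charts -/

section TangentChart

variable {E : Type*} [NormedAddCommGroup E] [InnerProductSpace ℝ E]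
  {X : Type*} [TopologicalSpace X] [ChartedSpace E X] [IsManifold 𝓘(ℝ, E) ∞ X]

local notation "TX" => TangentBundle 𝓘(ℝ, E) X
local notation "Atlas∞" => IsManifold.maximalAtlas 𝓘(ℝ, E) ∞ X

/-- The chart of the tangent bundle induced by a chart of the base: position and velocity in
coordinates. -/
def tangentChart (φ : OpenPartialHomeomorph X E) (p : TX) : E × E :=
  (φ p.1, chartDeriv φ p.1 p.2)

/-- The inverse of `tangentChart`. -/
def tangentChartSymm (φ : OpenPartialHomeomorph X E) (z : E × E) : TX :=
  ⟨φ.symm z.1, chartSymmDeriv φ z.1 z.2⟩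

variable {φ χ : OpenPartialHomeomorph X E}

omit [IsManifold 𝓘(ℝ, E) ∞ X] in
theorem tangentChart_symm (hφ : φ ∈ Atlas∞) {z : E × E} (hz : z.1 ∈ φ.target) :
    tangentChart φ (tangentChartSymm φ z) = z :=
  Prod.ext (φ.right_inv hz) (chartDeriv_chartSymmDeriv hφ hz z.2)

omit [IsManifold 𝓘(ℝ, E) ∞ X] in
theorem tangentChartSymm_tangentChart (hφ : φ ∈ Atlas∞) {p : TX} (hp : p.1 ∈ φ.source) :
    tangentChartSymm φ (tangentChart φ p) = p := by
  obtain ⟨x, v⟩ := p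
  have h : ∀ (x' : X) (v' : E), x' = x → v' = v →
      (⟨x', v'⟩ : TX) = ⟨x, v⟩ := by
    rintro _ _ rfl rfl
    rfl
  exact h _ _ (φ.left_inv hp) (chartSymmDeriv_chartDeriv hφ hp v)

theorem contMDiff_proj : ContMDiff (𝓘(ℝ, E)).tangent 𝓘(ℝ, E) ∞ (fun p : TX => p.1) :=
  Bundle.contMDiff_proj (TangentSpace 𝓘(ℝ, E))

theorem continuous_tangentProj : Continuous (fun p : TX => p.1) := contMDiff_proj.continuous

theorem contMDiffOn_tangentChart (hφ : φ ∈ Atlas∞) :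
    ContMDiffOn (𝓘(ℝ, E)).tangent 𝓘(ℝ, E × E) ∞ (tangentChart φ) {p : TX | p.1 ∈ φ.source} := by
  have h1 : ContMDiffOn (𝓘(ℝ, E)).tangent 𝓘(ℝ, E) ∞ (fun p : TX => φ p.1)
      {p : TX | p.1 ∈ φ.source} :=
    (contMDiffOn_of_mem_maximalAtlas hφ).comp contMDiff_proj.contMDiffOn fun p hp => hp
  have h2 := (contMDiffOn_of_mem_maximalAtlas hφ).contMDiffOn_tangentMapWithin (m := ∞)
    (by simp) φ.open_source.uniqueMDiffOn
  have h3 := (contMDiff_snd_tangentBundle_modelSpace E 𝓘(ℝ, E) (n := ∞)).comp_contMDiffOn h2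
  have h4 : ContMDiffOn (𝓘(ℝ, E)).tangent 𝓘(ℝ, E) ∞ (fun p : TX => chartDeriv φ p.1 p.2)
      {p : TX | p.1 ∈ φ.source} := by
    refine h3.congr fun p hp => ?_
    have h5 := mfderivWithin_of_isOpen (I := 𝓘(ℝ, E)) (I' := 𝓘(ℝ, E)) (f := φ) φ.open_source hp
    exact (congrArg (fun L : E →L[ℝ] E => L p.2) h5).symm
  exact h1.prodMk_space h4

theorem contMDiffOn_tangentChartSymm (hφ : φ ∈ Atlas∞) :
    ContMDiffOn 𝓘(ℝ, E × E) (𝓘(ℝ, E)).tangent ∞ (tangentChartSymm φ : E × E → TX)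
      (φ.target ×ˢ univ) := by
  have h2 := (contMDiffOn_symm_of_mem_maximalAtlas hφ).contMDiffOn_tangentMapWithin (m := ∞)
    (by simp) φ.open_target.uniqueMDiffOn
  have h0 : ContMDiff 𝓘(ℝ, E × E) (𝓘(ℝ, E)).tangent ∞
      (fun z : E × E => (⟨z.1, z.2⟩ : TangentBundle 𝓘(ℝ, E) E)) := by
    intro z
    refine Bundle.contMDiffAt_totalSpace.2 ⟨contDiff_fst.contMDiff.contMDiffAt, ?_⟩
    simp only [trivializationAt_model_space_apply]
    exact contDiff_snd.contMDiff.contMDiffAt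
  have h3 := h2.comp (s := (φ.target ×ˢ univ : Set (E × E))) h0.contMDiffOn fun z hz => hz.1
  refine h3.congr fun z hz => ?_
  have h5 := mfderivWithin_of_isOpen (I := 𝓘(ℝ, E)) (I' := 𝓘(ℝ, E)) (f := φ.symm)
    φ.open_target hz.1
  exact (congrArg (fun L : E →L[ℝ] E => (⟨φ.symm z.1, L z.2⟩ : TX)) h5).symm

theorem chartDeriv_chartAt_self (x : X) : chartDeriv (chartAt E x) x = ContinuousLinearMap.id ℝ E :=
  mfderiv_extChartAt_self

theorem chartSymmDeriv_chartAt_self (x : X) :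
    chartSymmDeriv (chartAt E x) (chartAt E x x) = ContinuousLinearMap.id ℝ E := by
  refine ContinuousLinearMap.ext fun v => ?_
  have h := chartSymmDeriv_chartDeriv (chartAt_mem_maximalAtlas x) (mem_chart_source E x) v
  rwa [chartDeriv_chartAt_self] at h

theorem tangentChart_chartAt_self (p : TX) :
    tangentChart (chartAt E p.1) p = (chartAt E p.1 p.1, p.2) := by
  rw [tangentChart, chartDeriv_chartAt_self]
  rfl

/-- The preferred charts of the tangent bundle are the ones induced by the preferred charts of the
base. -/
theorem extChartAt_tangent_apply (p₀ : TX) {p : TX} (hp : p.1 ∈ (chartAt E p₀.1).source) :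
    extChartAt (𝓘(ℝ, E)).tangent p₀ p = tangentChart (chartAt E p₀.1) p := by
  have h1 := TangentBundle.continuousLinearMapAt_trivializationAt (I := 𝓘(ℝ, E)) hp
  have h2 : chartDeriv (chartAt E p₀.1) p.1 p.2 =
      (trivializationAt E (TangentSpace 𝓘(ℝ, E)) p₀.1 p).2 := by
    refine (congrArg (fun L : E →L[ℝ] E => L p.2) h1).symm.trans ?_
    exact Trivialization.continuousLinearMapAt_apply_of_mem ℝ _ hp p.2
  rw [tangentChart, h2]
  rfl

/-- The spray in the chart induced by a chart of the base. -/
def sprayVec (g : StrongMetric E X) (φ : OpenPartialHomeomorph X E) (z : E × E) : E × E :=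
  (z.2, geodAccel (chartMetric g φ) z.1 z.2)

/-- The coordinate expression of the derivative of a self-map of the base. -/
def coordTangentMap (φ χ : OpenPartialHomeomorph X E) (f : X → X) (z : E × E) : E × E :=
  (coordMap φ χ f z.1, fderiv ℝ (coordMap φ χ f) z.1 z.2)

omit [IsManifold 𝓘(ℝ, E) ∞ X] in
theorem tangentChart_tangentMap (hφ : φ ∈ Atlas∞) (hχ : χ ∈ Atlas∞) {f : X → X}
    (hf : ContMDiff 𝓘(ℝ, E) 𝓘(ℝ, E) ∞ f) {p : TX} (hp : p.1 ∈ χ.source) (hfp : f p.1 ∈ φ.source) :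
    tangentChart φ (tangentMap 𝓘(ℝ, E) 𝓘(ℝ, E) f p) =
      coordTangentMap φ χ f (tangentChart χ p) := by
  have hq : χ p.1 ∈ coordDomain φ χ f := ⟨χ.map_source hp, by
    simpa only [mem_preimage, χ.left_inv hp] using hfp⟩
  refine Prod.ext ?_ ?_
  · show φ (f p.1) = φ (f (χ.symm (χ p.1)))
    rw [χ.left_inv hp]
  · show _ = fderiv ℝ (coordMap φ χ f) (χ p.1) (chartDeriv χ p.1 p.2)
    rw [fderiv_coordMap hφ hχ hf hq]
    have h1 : chartSymmDeriv χ (χ p.1) (chartDeriv χ p.1 p.2) = p.2 :=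
      chartSymmDeriv_chartDeriv hχ hp p.2
    exact (congrArg₂ (fun x (v : E) => chartDeriv φ (f x) (selfDeriv f x v))
      (χ.left_inv hp) h1).symm

variable [CompleteSpace E]

theorem contDiffOn_sprayVec (g : StrongMetric E X) (hφ : φ ∈ Atlas∞) :
    ContDiffOn ℝ ∞ (sprayVec g φ) (φ.target ×ˢ univ) :=
  contDiff_snd.contDiffOn.prodMk (contDiffOn_geodAccel φ.open_target (contDiffOn_chartMetric g hφ)
    fun _ hq => isInvertible_chartMetric g hφ hq)

/-- Isometries map solutions of the geodesic equation to solutions, in coordinates. -/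
theorem hasDerivAt_coordTangentMap (g : StrongMetric E X) (hφ : φ ∈ Atlas∞) (hχ : χ ∈ Atlas∞)
    {f : X → X} (hf : ContMDiff 𝓘(ℝ, E) 𝓘(ℝ, E) ∞ f)
    (hiso : ∀ x a b, metricAt g (f x) (selfDeriv f x a) (selfDeriv f x b) = metricAt g x a b)
    (hsurj : ∀ x, Function.Surjective (selfDeriv f x : E → E))
    {c : ℝ → E × E} {t : ℝ} (hc : HasDerivAt c (sprayVec g χ (c t)) t)
    (hq : (c t).1 ∈ coordDomain φ χ f) :
    HasDerivAt (coordTangentMap φ χ f ∘ c) (sprayVec g φ (coordTangentMap φ χ f (c t))) t := by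
  set σ := coordMap φ χ f with hσdef
  have hdo : coordDomain φ χ f ∈ 𝓝 (c t).1 := (isOpen_coordDomain hf.continuous).mem_nhds hq
  have hσ : ContDiffAt ℝ ∞ σ (c t).1 := (contDiffOn_coordMap hφ hχ hf).contDiffAt hdo
  have hσ1 : HasFDerivAt σ (fderiv ℝ σ (c t).1) (c t).1 :=
    (hσ.differentiableAt (by simp)).hasFDerivAt
  have hσ2 : HasFDerivAt (fderiv ℝ σ) (fderiv ℝ (fderiv ℝ σ) (c t).1) (c t).1 :=
    ((hσ.fderiv_right (m := ∞) (by simp)).differentiableAt (by simp)).hasFDerivAt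
  have hσq : σ (c t).1 ∈ φ.target := φ.map_source hq.2
  have hsurj' : Function.Surjective (fderiv ℝ σ (c t).1) := by
    intro w
    obtain ⟨u, hu⟩ := hsurj (χ.symm (c t).1) (chartSymmDeriv φ (σ (c t).1) w)
    refine ⟨chartDeriv χ (χ.symm (c t).1) u, ?_⟩
    rw [fderiv_coordMap hφ hχ hf hq]
    have h1 := chartSymmDeriv_chartDeriv hχ (χ.map_target hq.1) u
    rw [χ.right_inv hq.1] at h1
    rw [h1, hu]
    have h2 := chartDeriv_chartSymmDeriv hφ hσq w
    rwa [show φ.symm (σ (c t).1) = f (χ.symm (c t).1) from φ.left_inv hq.2] at h2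
  have key := geodAccel_map (G := chartMetric g χ) (G' := chartMetric g φ) (σ := σ) (q := (c t).1)
    (c t).2 (contDiffAt_infty.1 hσ 2) hsurj'
    (by filter_upwards [hdo] with z hz a b using chartMetric_pullback g hφ hχ hf hiso hz a b)
    (((contDiffOn_chartMetric g hχ).contDiffAt (χ.open_target.mem_nhds hq.1)).differentiableAt
      (by simp))
    (((contDiffOn_chartMetric g hφ).contDiffAt (φ.open_target.mem_nhds hσq)).differentiableAt
      (by simp))
    (fun a b => chartMetric_symm g φ _ a b) (isInvertible_chartMetric g hχ hq.1)
    (isInvertible_chartMetric g hφ hσq)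
  have hc1 : HasDerivAt (fun s => (c s).1) (c t).2 t := hc.fst
  have hc2 : HasDerivAt (fun s => (c s).2) (geodAccel (chartMetric g χ) (c t).1 (c t).2) t := hc.snd
  have h1 : HasDerivAt (fun s => σ (c s).1) (fderiv ℝ σ (c t).1 (c t).2) t :=
    HasFDerivAt.comp_hasDerivAt (f := fun s => (c s).1) t hσ1 hc1
  have h2 : HasDerivAt (fun s => fderiv ℝ σ (c s).1) (fderiv ℝ (fderiv ℝ σ) (c t).1 (c t).2) t :=
    HasFDerivAt.comp_hasDerivAt (f := fun s => (c s).1) t hσ2 hc1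
  have h3 := h1.prodMk (h2.clm_apply hc2)
  refine h3.congr_deriv (Prod.ext rfl ?_)
  exact key.symm

theorem sprayAccel_eq (g : StrongMetric E X) (x : X) (v : E) :
    sprayAccel g x v = geodAccel (chartMetric g (chartAt E x)) (chartAt E x x) v := by
  symm
  refine geodAccel_eq_of_apply (isInvertible_chartMetric g (chartAt_mem_maximalAtlas x)
    (mem_chart_target E x)) fun w => ?_
  rw [chartMetric_apply, chartSymmDeriv_chartAt_self, (chartAt E x).left_inv (mem_chart_source E x)]
  exact (g.exists_riesz x (sprayForm g x v)).choose_spec w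

theorem metricSpray_eq (g : StrongMetric E X) (p : TX) :
    metricSpray g p = sprayVec g (chartAt E p.1) (tangentChart (chartAt E p.1) p) := by
  rw [tangentChart_chartAt_self]
  exact Prod.ext rfl (sprayAccel_eq g p.1 p.2)

/-- `β` is tangent to the spray at time `t`. -/
def IsTangentToSpray (g : StrongMetric E X) (β : ℝ → TX) (t : ℝ) : Prop :=
  HasMFDerivAt 𝓘(ℝ, ℝ) (𝓘(ℝ, E)).tangent β t
    ((1 : ℝ →L[ℝ] ℝ).smulRight (metricSpray g (β t)))

theorem isTangentToSpray_iff_chartAt (g : StrongMetric E X) {β : ℝ → TX} {t : ℝ} :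
    IsTangentToSpray g β t ↔ ContinuousAt β t ∧
      HasDerivAt (tangentChart (chartAt E (β t).1) ∘ β)
        (sprayVec g (chartAt E (β t).1) (tangentChart (chartAt E (β t).1) (β t))) t := by
  rw [← metricSpray_eq]
  refine and_congr_right fun hc => ?_
  have hev : tangentChart (chartAt E (β t).1) ∘ β =ᶠ[𝓝 t]
      extChartAt (𝓘(ℝ, E)).tangent (β t) ∘ β := by
    have h1 : ∀ᶠ s in 𝓝 t, (β s).1 ∈ (chartAt E (β t).1).source :=
      (continuous_tangentProj.continuousAt.comp hc).eventually
        ((chartAt E (β t).1).open_source.mem_nhds (mem_chart_source E _))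
    filter_upwards [h1] with s hs
    exact (extChartAt_tangent_apply _ hs).symm
  let f' : ℝ →L[ℝ] E × E := (1 : ℝ →L[ℝ] ℝ).smulRight (metricSpray g (β t) : E × E)
  have h0 : HasFDerivWithinAt (extChartAt (𝓘(ℝ, E)).tangent (β t) ∘ β) f' (range 𝓘(ℝ, ℝ)) t ↔
      HasFDerivAt (extChartAt (𝓘(ℝ, E)).tangent (β t) ∘ β) f' t := by
    rw [ModelWithCorners.range_eq_univ, hasFDerivWithinAt_univ]
  refine Iff.trans h0 ⟨fun h => ?_, fun h => ?_⟩
  · exact (h.hasDerivAt.congr_of_eventuallyEq hev).congr_deriv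
      (one_smul ℝ (metricSpray g (β t) : E × E))
  · exact (h.congr_of_eventuallyEq hev.symm).hasFDerivAt

/-- Isometries of the base preserve the curves that are tangent to the spray, and the condition can
be checked in any charts. -/
theorem hasDerivAt_tangentChart_tangentMap (g : StrongMetric E X) (hφ : φ ∈ Atlas∞)
    (hχ : χ ∈ Atlas∞) {f : X → X} (hf : ContMDiff 𝓘(ℝ, E) 𝓘(ℝ, E) ∞ f)
    (hiso : ∀ x a b, metricAt g (f x) (selfDeriv f x a) (selfDeriv f x b) = metricAt g x a b)
    (hsurj : ∀ x, Function.Surjective (selfDeriv f x : E → E))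
    {β : ℝ → TX} {t : ℝ} (hβ : ContinuousAt β t)
    (hc : HasDerivAt (tangentChart χ ∘ β) (sprayVec g χ (tangentChart χ (β t))) t)
    (hp : (β t).1 ∈ χ.source) (hfp : f (β t).1 ∈ φ.source) :
    HasDerivAt (tangentChart φ ∘ tangentMap 𝓘(ℝ, E) 𝓘(ℝ, E) f ∘ β)
      (sprayVec g φ (tangentChart φ (tangentMap 𝓘(ℝ, E) 𝓘(ℝ, E) f (β t)))) t := by
  have hq : (tangentChart χ (β t)).1 ∈ coordDomain φ χ f := ⟨χ.map_source hp, by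
    show f (χ.symm (χ (β t).1)) ∈ φ.source
    rwa [χ.left_inv hp]⟩
  have h1 := hasDerivAt_coordTangentMap g hφ hχ hf hiso hsurj hc hq
  rw [tangentChart_tangentMap hφ hχ hf hp hfp]
  refine h1.congr_of_eventuallyEq ?_
  have hβ1 : ContinuousAt (fun s => (β s).1) t := continuous_tangentProj.continuousAt.comp hβ
  filter_upwards [hβ1.eventually (χ.open_source.mem_nhds hp),
    (hf.continuous.continuousAt.comp hβ1).eventually (φ.open_source.mem_nhds hfp)] with s hs hs'
  exact tangentChart_tangentMap hφ hχ hf hs hs'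

theorem isTangentToSpray_iff (g : StrongMetric E X) (hφ : φ ∈ Atlas∞) {β : ℝ → TX} {t : ℝ}
    (hp : (β t).1 ∈ φ.source) :
    IsTangentToSpray g β t ↔ ContinuousAt β t ∧
      HasDerivAt (tangentChart φ ∘ β) (sprayVec g φ (tangentChart φ (β t))) t := by
  rw [isTangentToSpray_iff_chartAt]
  refine and_congr_right fun hc => ?_
  have hid : ∀ p : TX, tangentMap 𝓘(ℝ, E) 𝓘(ℝ, E) (id : X → X) p = p := fun p => by
    rw [tangentMap_id]
    rfl
  have hiso : ∀ (x : X) (a b : E), metricAt g (id x) (selfDeriv id x a) (selfDeriv id x b) =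
      metricAt g x a b := fun x a b => by rw [selfDeriv_id]; rfl
  have hsurj : ∀ x : X, Function.Surjective (selfDeriv (id : X → X) x : E → E) := fun x => by
    rw [selfDeriv_id]
    exact Function.surjective_id
  have h1 := chartAt_mem_maximalAtlas (E := E) (β t).1
  have h2 := mem_chart_source E (β t).1
  constructor
  · intro h
    have h3 := hasDerivAt_tangentChart_tangentMap g hφ h1 contMDiff_id hiso hsurj hc h h2 hp
    rw [hid] at h3
    exact h3.congr_of_eventuallyEq (Eventually.of_forall fun s => (congrArg _ (hid (β s))).symm)
  · intro h
    have h3 := hasDerivAt_tangentChart_tangentMap g h1 hφ contMDiff_id hiso hsurj hc h hp h2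
    rw [hid] at h3
    exact h3.congr_of_eventuallyEq (Eventually.of_forall fun s => (congrArg _ (hid (β s))).symm)

theorem isTangentToSpray_tangentMap (g : StrongMetric E X) {f : X → X}
    (hf : ContMDiff 𝓘(ℝ, E) 𝓘(ℝ, E) ∞ f)
    (hiso : ∀ x a b, metricAt g (f x) (selfDeriv f x a) (selfDeriv f x b) = metricAt g x a b)
    (hsurj : ∀ x, Function.Surjective (selfDeriv f x : E → E))
    {β : ℝ → TX} {t : ℝ} (h : IsTangentToSpray g β t) :
    IsTangentToSpray g (tangentMap 𝓘(ℝ, E) 𝓘(ℝ, E) f ∘ β) t := by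
  rw [isTangentToSpray_iff_chartAt] at h
  have h1 := hasDerivAt_tangentChart_tangentMap g (chartAt_mem_maximalAtlas (E := E) (f (β t).1))
    (chartAt_mem_maximalAtlas (E := E) (β t).1) hf hiso hsurj h.1 h.2 (mem_chart_source E _)
    (mem_chart_source E _)
  have h2 : Continuous (tangentMap 𝓘(ℝ, E) 𝓘(ℝ, E) f) := hf.continuous_tangentMap (by simp)
  exact (isTangentToSpray_iff_chartAt g).2 ⟨h2.continuousAt.comp h.1, h1⟩

end TangentChart

/-! ### Integral curves of the spray and the exponential map -/

section SprayCurve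

variable {E : Type*} [NormedAddCommGroup E] [InnerProductSpace ℝ E]
  {X : Type*} [TopologicalSpace X] [ChartedSpace E X] [IsManifold 𝓘(ℝ, E) ∞ X]

local notation "TX" => TangentBundle 𝓘(ℝ, E) X
local notation "Atlas∞" => IsManifold.maximalAtlas 𝓘(ℝ, E) ∞ X

variable {φ : OpenPartialHomeomorph X E}

theorem isOpen_tangentChart_preimage (hφ : φ ∈ Atlas∞) {u : Set (E × E)} (hu : IsOpen u) :
    IsOpen {p : TX | p.1 ∈ φ.source ∧ tangentChart φ p ∈ u} :=
  (contMDiffOn_tangentChart hφ).continuousOn.isOpen_inter_preimage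
    (φ.open_source.preimage continuous_tangentProj) hu

theorem t2Space_tangentBundle [T2Space X] : T2Space TX := by
  refine ⟨fun p p' hne => ?_⟩
  by_cases hb : p.1 = p'.1
  · set φ := chartAt E p.1 with hφ
    have hφm : φ ∈ Atlas∞ := chartAt_mem_maximalAtlas p.1
    have h1 : p.1 ∈ φ.source := mem_chart_source E p.1
    have h2 : p'.1 ∈ φ.source := hb ▸ h1
    have h3 : tangentChart φ p ≠ tangentChart φ p' := fun h => hne <| by
      rw [← tangentChartSymm_tangentChart hφm h1, h, tangentChartSymm_tangentChart hφm h2]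
    obtain ⟨u, v, hu, hv, hpu, hpv, huv⟩ := t2_separation h3
    exact ⟨_, _, isOpen_tangentChart_preimage hφm hu, isOpen_tangentChart_preimage hφm hv,
      ⟨h1, hpu⟩, ⟨h2, hpv⟩, Set.disjoint_left.2 fun r hr hr' =>
        Set.disjoint_left.1 huv hr.2 hr'.2⟩
  · obtain ⟨u, v, hu, hv, hpu, hpv, huv⟩ := t2_separation hb
    exact ⟨_, _, hu.preimage continuous_tangentProj, hv.preimage continuous_tangentProj, hpu, hpv,
      huv.preimage _⟩

variable [CompleteSpace E]

theorem isSprayCurve_iff (g : StrongMetric E X) {p : TX} {β : ℝ → TX} :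
    IsSprayCurve g p β ↔
      β 0 = p ∧ ∃ ε > 0, ∀ t ∈ Ioo (-ε) (1 + ε), IsTangentToSpray g β t := by
  refine and_congr_right fun _ => exists_congr fun ε => and_congr_right fun _ => ?_
  exact forall₂_congr fun t ht =>
    ⟨fun h => h.hasMFDerivAt (isOpen_Ioo.mem_nhds ht), fun h => HasMFDerivAt.hasMFDerivWithinAt h⟩

/-- Local uniqueness of the integral curves of the spray. -/
theorem eventuallyEq_of_isTangentToSpray (g : StrongMetric E X) {β β' : ℝ → TX} {t : ℝ}
    (h : ∀ᶠ s in 𝓝 t, IsTangentToSpray g β s) (h' : ∀ᶠ s in 𝓝 t, IsTangentToSpray g β' s)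
    (ht : β t = β' t) : β =ᶠ[𝓝 t] β' := by
  set φ := chartAt E (β t).1 with hφ
  have hφm : φ ∈ Atlas∞ := chartAt_mem_maximalAtlas (β t).1
  have hp : (β t).1 ∈ φ.source := mem_chart_source E (β t).1
  obtain ⟨K, s, hs, hK⟩ := (contDiffAt_infty.1 ((contDiffOn_sprayVec g hφm).contDiffAt
    (x := tangentChart φ (β t))
    ((φ.open_target.prod isOpen_univ).mem_nhds ⟨φ.map_source hp, mem_univ _⟩)) 1
    ).exists_lipschitzOnWith
  have key : ∀ {γ : ℝ → TX}, (∀ᶠ s in 𝓝 t, IsTangentToSpray g γ s) → γ t = β t →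
      (∀ᶠ r in 𝓝 t, HasDerivAt (tangentChart φ ∘ γ) (sprayVec g φ (tangentChart φ (γ r))) r ∧
        tangentChart φ (γ r) ∈ s) ∧ ∀ᶠ r in 𝓝 t, (γ r).1 ∈ φ.source := by
    intro γ hγ hγt
    have hp' : (γ t).1 ∈ φ.source := hγt ▸ hp
    have hc : ContinuousAt γ t := hγ.self_of_nhds.1
    have h1 : ∀ᶠ r in 𝓝 t, (γ r).1 ∈ φ.source :=
      (continuous_tangentProj.continuousAt.comp hc).eventually (φ.open_source.mem_nhds hp')
    have h2 : ContinuousAt (tangentChart φ ∘ γ) t :=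
      ((isTangentToSpray_iff g hφm hp').1 hγ.self_of_nhds).2.continuousAt
    have h3 : s ∈ 𝓝 ((tangentChart φ ∘ γ) t) := by
      rw [Function.comp_apply, hγt]
      exact hs
    refine ⟨?_, h1⟩
    filter_upwards [h1, hγ, h2.eventually h3] with r hr hr' hr''
    exact ⟨((isTangentToSpray_iff g hφm hr).1 hr').2, hr''⟩
  obtain ⟨h1, h2⟩ := key h rfl
  obtain ⟨h1', h2'⟩ := key h' ht.symm
  have h3 := ODE_solution_unique_of_eventually (v := fun _ => sprayVec g φ) (s := fun _ => s)
    (K := K) (Eventually.of_forall fun _ => hK) h1 h1' (congrArg (tangentChart φ) ht)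
  filter_upwards [h3, h2, h2'] with r hr hr2 hr2'
  rw [← tangentChartSymm_tangentChart hφm hr2, ← tangentChartSymm_tangentChart hφm hr2']
  exact congrArg _ hr

/-- On a Hausdorff manifold, the integral curves of the spray are unique. -/
theorem IsSprayCurve.apply_one_eq [T2Space X] {g : StrongMetric E X} {p : TX} {β β' : ℝ → TX}
    (h : IsSprayCurve g p β) (h' : IsSprayCurve g p β') : β 1 = β' 1 := by
  have := t2Space_tangentBundle (E := E) (X := X)
  obtain ⟨h0, ε, hε, h⟩ := (isSprayCurve_iff g).1 h
  obtain ⟨h0', ε', hε', h'⟩ := (isSprayCurve_iff g).1 h'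
  set I : Set ℝ := Ioo (-ε) (1 + ε) ∩ Ioo (-ε') (1 + ε')
  have hIo : IsOpen I := isOpen_Ioo.inter isOpen_Ioo
  set u : Set ℝ := {t | t ∈ I ∧ β t = β' t}
  have hI : IsPreconnected I := ((ordConnected_Ioo).inter ordConnected_Ioo).isPreconnected
  have h0I : (0 : ℝ) ∈ I := ⟨⟨by linarith, by linarith⟩, by linarith, by linarith⟩
  have h1I : (1 : ℝ) ∈ I := ⟨⟨by linarith, by linarith⟩, by linarith, by linarith⟩
  have huo : IsOpen u := by
    refine isOpen_iff_mem_nhds.2 fun t ht => ?_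
    have hIt := hIo.mem_nhds ht.1
    have h3 := eventuallyEq_of_isTangentToSpray g (β := β) (β' := β') (t := t)
      (by filter_upwards [hIt] with r hr using h r hr.1)
      (by filter_upwards [hIt] with r hr using h' r hr.2) ht.2
    filter_upwards [hIt, h3] with r hr hr' using ⟨hr, hr'⟩
  refine (hI.subset_of_closure_inter_subset huo ⟨0, h0I, h0I, h0.trans h0'.symm⟩ ?_ h1I).2
  rintro t ⟨htu, htI⟩
  refine ⟨htI, ?_⟩
  have hne := mem_closure_iff_nhdsWithin_neBot.1 htu
  have hc : Tendsto β (𝓝[u] t) (𝓝 (β t)) := (h t htI.1).1.tendsto.mono_left nhdsWithin_le_nhds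
  have hc' : Tendsto β' (𝓝[u] t) (𝓝 (β' t)) :=
    (h' t htI.2).1.tendsto.mono_left nhdsWithin_le_nhds
  refine tendsto_nhds_unique hc (hc'.congr' ?_)
  filter_upwards [self_mem_nhdsWithin] with r hr using hr.2.symm

theorem riemannianExp_eq [T2Space X] {g : StrongMetric E X} {p : TX} {β : ℝ → TX}
    (h : IsSprayCurve g p β) : riemannianExp g p = (β 1).1 := by
  have hp : p ∈ expDomain g := ⟨β, h⟩
  rw [riemannianExp, dif_pos hp]
  exact congrArg (fun p : TX => p.1) (IsSprayCurve.apply_one_eq (Exists.choose_spec hp) h)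

/-- The exponential map in the chart of the tangent bundle around a zero vector. -/
theorem exists_riemannianExp_tangentChartSymm [T2Space X] (g : StrongMetric E X) (hφ : φ ∈ Atlas∞)
    {q₀ : E} (hq₀ : q₀ ∈ φ.target) :
    ∃ (W : Set (E × E)) (e : E × E → E), IsOpen W ∧ (q₀, 0) ∈ W ∧ W ⊆ φ.target ×ˢ univ ∧
      ContDiffOn ℝ ∞ e W ∧
      HasFDerivAt e (ContinuousLinearMap.fst ℝ E E + ContinuousLinearMap.snd ℝ E E) (q₀, 0) ∧
      e (q₀, 0) = q₀ ∧
      ∀ z ∈ W, e z ∈ φ.target ∧ tangentChartSymm φ z ∈ expDomain g ∧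
        riemannianExp g (tangentChartSymm φ z) = φ.symm (e z) := by
  set A : E × E → E := fun z => geodAccel (chartMetric g φ) z.1 z.2
  have hA : ContDiffOn ℝ ∞ A (φ.target ×ˢ univ) := contDiffOn_geodAccel φ.open_target
    (contDiffOn_chartMetric g hφ) fun _ hq => isInvertible_chartMetric g hφ hq
  have hA0 : ∀ q, A (q, 0) = 0 := fun q => by
    have h := geodAccel_smul (G := chartMetric g φ) q 0 0
    rw [zero_smul] at h
    exact h.trans (by rw [zero_pow two_ne_zero, zero_smul])
  have hAd : HasFDerivAt A (fderiv ℝ A (q₀, 0)) (q₀, 0) :=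
    ((hA.contDiffAt ((φ.open_target.prod isOpen_univ).mem_nhds ⟨hq₀, mem_univ _⟩)
      ).differentiableAt (by simp)).hasFDerivAt
  have hA' : fderiv ℝ A (q₀, 0) = 0 := by
    refine ContinuousLinearMap.ext fun w => ?_
    obtain ⟨a, b⟩ := w
    have hab : ((a, b) : E × E) = (a, 0) + (0, b) := by simp
    have h1 : fderiv ℝ A (q₀, 0) (a, 0) = 0 := by
      have hl : HasDerivAt (fun s : ℝ => ((q₀, 0) : E × E) + s • (a, 0)) (a, 0) 0 := by
        simpa using ((hasDerivAt_id (0 : ℝ)).smul_const ((a, 0) : E × E)).const_add (q₀, (0 : E))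
      have h2 := HasFDerivAt.comp_hasDerivAt (l := A) (0 : ℝ) (by simpa using hAd) hl
      have h3 : A ∘ (fun s : ℝ => ((q₀, 0) : E × E) + s • (a, 0)) = fun _ => 0 := by
        funext s
        simp [hA0]
      rw [h3] at h2
      exact h2.unique (hasDerivAt_const _ _)
    have h1' : fderiv ℝ A (q₀, 0) (0, b) = 0 := by
      have hl : HasDerivAt (fun s : ℝ => ((q₀, 0) : E × E) + s • (0, b)) (0, b) 0 := by
        simpa using ((hasDerivAt_id (0 : ℝ)).smul_const ((0, b) : E × E)).const_add (q₀, (0 : E))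
      have h2 := HasFDerivAt.comp_hasDerivAt (l := A) (0 : ℝ) (by simpa using hAd) hl
      -- quadratic homogeneity in the velocity
      have h3 : A ∘ (fun s : ℝ => ((q₀, 0) : E × E) + s • (0, b)) = fun s => s ^ 2 • A (q₀, b) := by
        funext s
        simpa using geodAccel_smul (G := chartMetric g φ) q₀ b s
      rw [h3] at h2
      refine h2.unique ?_
      simpa using ((hasDerivAt_id (0 : ℝ)).pow 2).smul_const (A (q₀, b))
    rw [hab, map_add, h1, h1', add_zero]
    rfl
  obtain ⟨W, e, hWo, hqW, he, hed, heq, hW⟩ := exists_timeOneMap φ.open_target hA hq₀ (hA0 q₀) hA'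
  refine ⟨W, e, hWo, hqW, ?_, he, hed, heq, ?_⟩
  · intro z hz
    obtain ⟨c, h0, h1, hc⟩ := hW z hz
    refine ⟨?_, mem_univ _⟩
    rw [← h0]
    exact (hc 0 (by norm_num)).1
  · intro z hz
    obtain ⟨c, h0, h1, hc⟩ := hW z hz
    have hβ : IsSprayCurve g (tangentChartSymm φ z) (fun t => tangentChartSymm φ (c t)) := by
      refine (isSprayCurve_iff g).2 ⟨congrArg _ h0, 1, one_pos, fun t ht => ?_⟩
      have hmem : ∀ s ∈ Ioo (-1 : ℝ) 2, (c s).1 ∈ φ.target := fun s hs => (hc s hs).1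
      have ht' : t ∈ Ioo (-1 : ℝ) 2 := by
        rwa [show (1 : ℝ) + 1 = 2 by norm_num] at ht
      have htc := (hc t ht').2
      refine (isTangentToSpray_iff g hφ (φ.map_target (hmem t ht'))).2 ⟨?_, ?_⟩
      · exact ContinuousAt.comp (x := t) (f := c) (g := (tangentChartSymm φ : E × E → TX))
          ((contMDiffOn_tangentChartSymm hφ).continuousOn.continuousAt
            ((φ.open_target.prod isOpen_univ).mem_nhds ⟨hmem t ht', mem_univ _⟩)) htc.continuousAt
      · rw [tangentChart_symm hφ (hmem t ht')]
        refine htc.congr_of_eventuallyEq ?_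
        filter_upwards [isOpen_Ioo.mem_nhds ht'] with s hs
        exact tangentChart_symm hφ (hmem s hs)
    refine ⟨?_, ⟨_, hβ⟩, ?_⟩
    · rw [← h1]
      exact (hc 1 (by norm_num)).1
    · rw [riemannianExp_eq hβ, ← h1]
      rfl

end SprayCurve

/-! ### Equivariance -/

section Action

variable {E : Type*} [NormedAddCommGroup E] [InnerProductSpace ℝ E]
  {X : Type*} [TopologicalSpace X] [ChartedSpace E X] [IsManifold 𝓘(ℝ, E) ∞ X]
  {G : Type*} [Group G] [MulAction G X] {g : StrongMetric E X}

local notation "TX" => TangentBundle 𝓘(ℝ, E) X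

theorem tangentAct_mk (a : G) (x : X) (v : E) :
    tangentAct E a (⟨x, v⟩ : TX) = ⟨a • x, (selfDeriv (fun z : X => a • z) x v : E)⟩ := rfl

theorem tangentAct_fst (a : G) (p : TX) : (tangentAct E a p).1 = a • p.1 := rfl

variable (hG : ActsBySmoothIsometries G g)
include hG

theorem tangentAct_inv_tangentAct (a : G) (p : TX) : tangentAct E a⁻¹ (tangentAct E a p) = p := by
  have h1 := tangentMap_comp_at (I := 𝓘(ℝ, E)) (I' := 𝓘(ℝ, E)) (I'' := 𝓘(ℝ, E))
    (f := fun x : X => a • x) (g := fun x : X => a⁻¹ • x) p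
    ((hG a⁻¹).1.mdifferentiableAt (by simp)) ((hG a).1.mdifferentiableAt (by simp))
  rw [show (fun x : X => a⁻¹ • x) ∘ (fun x : X => a • x) = id from
    funext fun x => inv_smul_smul a x, tangentMap_id] at h1
  exact h1.symm

theorem tangentAct_tangentAct_inv (a : G) (p : TX) : tangentAct E a (tangentAct E a⁻¹ p) = p := by
  have h := tangentAct_inv_tangentAct hG a⁻¹ p
  rwa [inv_inv] at h

theorem contMDiff_tangentAct (a : G) : ContMDiff (𝓘(ℝ, E)).tangent (𝓘(ℝ, E)).tangent ∞
    (tangentAct E a : TX → TX) :=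
  (hG a).1.contMDiff_tangentMap (by simp)

theorem surjective_selfDeriv_smul (a : G) (x : X) :
    Function.Surjective (selfDeriv (fun z : X => a • z) x : E → E) := by
  intro w
  have h := tangentAct_tangentAct_inv hG a (⟨a • x, w⟩ : TX)
  have h2 : ∀ (x' : X) (v : E), x' = x → tangentAct E a (⟨x', v⟩ : TX) = ⟨a • x, w⟩ →
      selfDeriv (fun z : X => a • z) x v = w := by
    rintro _ v rfl h
    rw [tangentAct_mk] at h
    exact eq_of_heq (TotalSpace.mk.inj h).2
  exact ⟨_, h2 (a⁻¹ • a • x) (selfDeriv (fun z : X => a⁻¹ • z) (a • x) w) (inv_smul_smul a x) h⟩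

variable [CompleteSpace E]

theorem IsSprayCurve.tangentAct (a : G) {p : TX} {β : ℝ → TX} (h : IsSprayCurve g p β) :
    IsSprayCurve g (tangentAct E a p) (tangentAct E a ∘ β) := by
  obtain ⟨h0, ε, hε, h⟩ := (isSprayCurve_iff g).1 h
  exact (isSprayCurve_iff g).2 ⟨congrArg _ h0, ε, hε, fun t ht => isTangentToSpray_tangentMap g
    (hG a).1 (fun x v w => (hG a).2 x v w) (surjective_selfDeriv_smul hG a) (h t ht)⟩

theorem tangentAct_mem_expDomain (a : G) {p : TX} (hp : p ∈ expDomain g) :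
    tangentAct E a p ∈ expDomain g :=
  hp.elim fun _ h => ⟨_, h.tangentAct hG a⟩

theorem riemannianExp_tangentAct [T2Space X] (a : G) {p : TX} (hp : p ∈ expDomain g) :
    riemannianExp g (tangentAct E a p) = a • riemannianExp g p := by
  obtain ⟨β, h⟩ := hp
  rw [riemannianExp_eq h, riemannianExp_eq (h.tangentAct hG a)]
  rfl

end Action

/-! ### The distance of a strong metric -/

section Coercive

variable {E : Type*} [NormedAddCommGroup E] [InnerProductSpace ℝ E]

/-- An invertible symmetric positive definite form is coercive. -/
theorem exists_norm_sq_le_of_isInvertible {B : E →L[ℝ] E →L[ℝ] ℝ} (hsymm : ∀ a b, B a b = B b a)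
    (hpos : ∀ a, a ≠ 0 → 0 < B a a) (hinv : B.IsInvertible) :
    ∃ C > 0, ∀ a, ‖a‖ ^ 2 ≤ C * B a a := by
  obtain ⟨e, he⟩ := hinv
  have hnn : ∀ a, 0 ≤ B a a := fun a => by
    by_cases ha : a = 0
    · simp [ha]
    · exact (hpos a ha).le
  set K : ℝ := ‖(e.symm : (E →L[ℝ] ℝ) →L[ℝ] E)‖ with hK
  refine ⟨K + 1, by positivity, fun a => ?_⟩
  by_cases ha : a = 0
  · simp [ha]
  -- the vector `u` represents the inner product with `a`
  set u : E := e.symm (innerSL ℝ a)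
  have hu : ∀ w, B u w = inner ℝ a w := fun w => by
    have : B u = innerSL ℝ a := by
      rw [← he]
      exact e.apply_symm_apply _
    rw [this]
    rfl
  have hun : ‖u‖ ≤ K * ‖a‖ := by
    refine ((e.symm : (E →L[ℝ] ℝ) →L[ℝ] E).le_opNorm (innerSL ℝ a)).trans_eq ?_
    rw [innerSL_apply_norm]
  let B' : LinearMap.BilinForm ℝ E := LinearMap.mk₂ ℝ (fun a b => B a b) (by simp) (by simp)
    (by simp) (by simp)
  have hcs := LinearMap.BilinForm.apply_mul_apply_le_of_forall_zero_le B' hnn u a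
  have h1 : B u a * B a u ≤ B u u * B a a := hcs
  rw [hsymm a u, hu, hu, real_inner_self_eq_norm_sq] at h1
  have h2 : inner ℝ a u ≤ K * ‖a‖ ^ 2 := by
    refine (real_inner_le_norm a u).trans ?_
    nlinarith [norm_nonneg a]
  have ha' : 0 < ‖a‖ ^ 2 := by positivity
  have h3 : ‖a‖ ^ 2 * ‖a‖ ^ 2 ≤ ‖a‖ ^ 2 * (K * B a a) :=
    h1.trans ((mul_le_mul_of_nonneg_right h2 (hnn a)).trans_eq (by ring))
  have h4 := le_of_mul_le_mul_left h3 ha'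
  nlinarith [hnn a]

end Coercive

section MetricDist

variable {E : Type*} [NormedAddCommGroup E] [InnerProductSpace ℝ E]
  {X : Type*} [TopologicalSpace X] [ChartedSpace E X] [IsManifold 𝓘(ℝ, E) ∞ X]

local notation "Atlas∞" => IsManifold.maximalAtlas 𝓘(ℝ, E) ∞ X

variable {φ : OpenPartialHomeomorph X E}

/-- In a chart, the norm of the model space is locally bounded by the metric. -/
theorem eventually_norm_sq_le_chartMetric [CompleteSpace E] (g : StrongMetric E X) (hφ : φ ∈ Atlas∞)
    {q₀ : E} (hq₀ : q₀ ∈ φ.target) :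
    ∃ C > 0, ∀ᶠ q in 𝓝 q₀, ∀ a, ‖a‖ ^ 2 ≤ C ^ 2 * chartMetric g φ q a a := by
  obtain ⟨C, hC, h⟩ := exists_norm_sq_le_of_isInvertible (chartMetric_symm g φ q₀)
    (fun a ha => chartMetric_pos g hφ hq₀ ha) (isInvertible_chartMetric g hφ hq₀)
  refine ⟨√(2 * C), by positivity, ?_⟩
  have hc : ContinuousAt (chartMetric g φ) q₀ :=
    (contDiffOn_chartMetric g hφ).continuousOn.continuousAt (φ.open_target.mem_nhds hq₀)
  filter_upwards [Metric.continuousAt_iff'.1 hc (1 / (2 * C)) (by positivity)] with q hq a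
  rw [Real.sq_sqrt (by positivity)]
  rw [dist_eq_norm] at hq
  have h1 : ‖(chartMetric g φ q - chartMetric g φ q₀) a a‖ ≤ 1 / (2 * C) * ‖a‖ * ‖a‖ :=
    ((chartMetric g φ q - chartMetric g φ q₀).le_opNorm₂ a a).trans (by gcongr)
  have h2 : -(1 / (2 * C) * ‖a‖ * ‖a‖) ≤ chartMetric g φ q a a - chartMetric g φ q₀ a a :=
    (abs_le.1 h1).1
  have h3 : C * (1 / (2 * C) * ‖a‖ * ‖a‖) = ‖a‖ ^ 2 / 2 := by
    field_simp
  nlinarith [h a, mul_le_mul_of_nonneg_left h2 hC.le]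

/-- In a chart, the metric is locally bounded by the norm of the model space. -/
theorem eventually_chartMetric_le (g : StrongMetric E X) (hφ : φ ∈ Atlas∞)
    {q₀ : E} (hq₀ : q₀ ∈ φ.target) :
    ∃ C > 0, ∀ᶠ q in 𝓝 q₀, ∀ a, chartMetric g φ q a a ≤ (C * ‖a‖) ^ 2 := by
  have hc : ContinuousAt (chartMetric g φ) q₀ :=
    (contDiffOn_chartMetric g hφ).continuousOn.continuousAt (φ.open_target.mem_nhds hq₀)
  refine ⟨√(‖chartMetric g φ q₀‖ + 1), by positivity, ?_⟩
  filter_upwards [hc.norm.eventually (gt_mem_nhds (lt_add_one _))] with q hq a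
  rw [mul_pow, Real.sq_sqrt (by positivity)]
  refine (le_abs_self _).trans (((chartMetric g φ q).le_opNorm₂ a a).trans ?_)
  rw [mul_assoc, ← sq]
  gcongr

/-- The velocity of a curve. -/
def curveVel (γ : ℝ → X) (t : ℝ) : E := mfderiv 𝓘(ℝ, ℝ) 𝓘(ℝ, E) γ t (1 : ℝ)

/-- `γ` is differentiable on `[0, 1]` with speed at most `M`. -/
def HasSpeedLE (g : StrongMetric E X) (γ : ℝ → X) (M : ℝ) : Prop :=
  ∀ t ∈ Icc (0 : ℝ) 1, MDifferentiableAt 𝓘(ℝ, ℝ) 𝓘(ℝ, E) γ t ∧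
    metricAt g (γ t) (curveVel γ t) (curveVel γ t) ≤ M ^ 2

omit [IsManifold 𝓘(ℝ, E) ∞ X] in
theorem hasDerivAt_chart_comp (hφ : φ ∈ Atlas∞) {γ : ℝ → X} {t : ℝ}
    (hγ : MDifferentiableAt 𝓘(ℝ, ℝ) 𝓘(ℝ, E) γ t) (ht : γ t ∈ φ.source) :
    HasDerivAt (φ ∘ γ) (chartDeriv φ (γ t) (curveVel γ t)) t := by
  have h := ((mdifferentiable_of_mem_maximalAtlas hφ).mdifferentiableAt ht).hasMFDerivAt.comp t
    hγ.hasMFDerivAt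
  have h' : HasFDerivAt (φ ∘ γ) ((chartDeriv φ (γ t)).comp
      (mfderiv 𝓘(ℝ, ℝ) 𝓘(ℝ, E) γ t : ℝ →L[ℝ] E)) t := hasMFDerivAt_iff_hasFDerivAt.1 h
  exact h'.hasDerivAt

omit [IsManifold 𝓘(ℝ, E) ∞ X] in
theorem curveVel_chart_symm_comp (hφ : φ ∈ Atlas∞) {c : ℝ → E} {c' : E} {t : ℝ}
    (hc : HasDerivAt c c' t) (ht : c t ∈ φ.target) :
    MDifferentiableAt 𝓘(ℝ, ℝ) 𝓘(ℝ, E) (φ.symm ∘ c) t ∧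
      curveVel (φ.symm ∘ c) t = chartSymmDeriv φ (c t) c' := by
  have h := ((mdifferentiable_of_mem_maximalAtlas hφ).mdifferentiableAt_symm ht).hasMFDerivAt.comp t
    (hasMFDerivAt_iff_hasFDerivAt.2 hc.hasFDerivAt)
  refine ⟨h.mdifferentiableAt, ?_⟩
  have h2 := congrArg (fun L : ℝ →L[ℝ] E => L 1) h.mfderiv
  refine h2.trans ?_
  show chartSymmDeriv φ (c t) ((1 : ℝ) • c') = _
  rw [one_smul]

/-- The straight segments in a chart have bounded speed. -/
theorem hasSpeedLE_segment (g : StrongMetric E X) (hφ : φ ∈ Atlas∞) {q₀ : E} {R C : ℝ}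
    (hR : Metric.ball q₀ R ⊆ φ.target)
    (hC : ∀ q ∈ Metric.ball q₀ R, ∀ a, chartMetric g φ q a a ≤ (C * ‖a‖) ^ 2) {q q' : E}
    (hq : q ∈ Metric.ball q₀ R) (hq' : q' ∈ Metric.ball q₀ R) :
    HasSpeedLE g (φ.symm ∘ AffineMap.lineMap (k := ℝ) q q') (C * ‖q' - q‖) := by
  intro t ht
  have hm : AffineMap.lineMap (k := ℝ) q q' t ∈ Metric.ball q₀ R :=
    (convex_ball q₀ R).lineMap_mem hq hq' ht
  obtain ⟨h1, h2⟩ := curveVel_chart_symm_comp hφ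
    (AffineMap.hasDerivAt_lineMap (a := q) (b := q') (x := t)) (hR hm)
  refine ⟨h1, ?_⟩
  rw [h2]
  exact hC _ hm _

/-- Curves of bounded speed stay in a chart for some time. Here completeness of the model
space provides the position at the supremum of the times before which the curve stays in the chart,
and the Hausdorff property identifies it. -/
theorem HasSpeedLE.mem_ball [T2Space X] [CompleteSpace E] {g : StrongMetric E X} (hφ : φ ∈ Atlas∞)
    {q₀ : E} {R C M : ℝ} (hR : Metric.ball q₀ R ⊆ φ.target) (hC0 : 0 < C) (hM : 0 ≤ M)
    (hC : ∀ q ∈ Metric.ball q₀ R, ∀ a, ‖a‖ ^ 2 ≤ C ^ 2 * chartMetric g φ q a a) {γ : ℝ → X}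
    (hγ : HasSpeedLE g γ M) (h0 : γ 0 ∈ φ.source) (h0R : ‖φ (γ 0) - q₀‖ + C * M < R) :
    γ 1 ∈ φ.source ∧ φ (γ 1) ∈ Metric.ball q₀ R ∧ ‖φ (γ 1) - φ (γ 0)‖ ≤ C * M := by
  set N : Set X := φ.source ∩ φ ⁻¹' Metric.ball q₀ R with hN
  have hNo : IsOpen N := φ.isOpen_inter_preimage Metric.isOpen_ball
  have hCM : 0 ≤ C * M := by positivity
  have hN0 : γ 0 ∈ N := ⟨h0, by
    rw [mem_preimage, mem_ball_iff_norm]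
    linarith⟩
  -- as long as the curve stays in `N`, it is Lipschitz in the chart
  have hlip : ∀ r s, 0 ≤ r → r ≤ s → s ≤ 1 → (∀ τ ∈ Icc r s, γ τ ∈ N) →
      ‖φ (γ s) - φ (γ r)‖ ≤ C * M * (s - r) := by
    intro r s hr hrs hs hτ
    refine norm_image_sub_le_of_norm_deriv_le_segment' (f := φ ∘ γ)
      (f' := fun τ => chartDeriv φ (γ τ) (curveVel γ τ)) (fun τ h => ?_) (fun τ h => ?_) s
      (right_mem_Icc.2 hrs)
    · exact (hasDerivAt_chart_comp hφ (hγ τ ⟨hr.trans h.1, h.2.trans hs⟩).1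
        (hτ τ h).1).hasDerivWithinAt
    · have h' := Ico_subset_Icc_self h
      have h1 := (hγ τ ⟨hr.trans h'.1, h'.2.trans hs⟩).2
      rw [metricAt_eq_chartMetric g hφ (hτ τ h').1] at h1
      have h2 := hC _ (hτ τ h').2 (chartDeriv φ (γ τ) (curveVel γ τ))
      refine abs_le_of_sq_le_sq' ?_ hCM |>.2
      rw [mul_pow]
      exact h2.trans (by gcongr)
  set S : Set ℝ := {t | ∀ τ ∈ Icc 0 t, γ τ ∈ N} with hS
  have hcont : ∀ t ∈ Icc (0 : ℝ) 1, ContinuousAt γ t := fun t ht => (hγ t ht).1.continuousAt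
  have hclosed : IsClosed (S ∩ Icc 0 1) := by
    refine isClosed_of_closure_subset fun t ht => ?_
    have ht1 : t ∈ Icc (0 : ℝ) 1 :=
      isClosed_Icc.closure_subset_iff.2 inter_subset_right ht
    have hlt : ∀ τ, 0 ≤ τ → τ < t → γ τ ∈ N := by
      intro τ h0τ hτ
      obtain ⟨s, hs, hsS⟩ := mem_closure_iff.1 ht (Ioi τ) isOpen_Ioi hτ
      exact hsS.1 τ ⟨h0τ, le_of_lt hs⟩
    refine ⟨fun τ hτ => ?_, ht1⟩
    rcases hτ.2.lt_or_eq with h | rfl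
    · exact hlt τ hτ.1 h
    rcases hτ.1.lt_or_eq with hpos | h
    swap
    · rwa [← h]
    have hmem : Ico 0 τ ∈ 𝓝[<] τ := Ico_mem_nhdsLT hpos
    have hl : ∀ r s, 0 ≤ r → r ≤ s → s < τ → ‖φ (γ s) - φ (γ r)‖ ≤ C * M * (s - r) :=
      fun r s hr hrs hs => hlip r s hr hrs (hs.le.trans ht1.2) fun σ hσ =>
        hlt σ (hr.trans hσ.1) (hσ.2.trans_lt hs)
    have hcauchy : Cauchy (map (φ ∘ γ) (𝓝[<] τ)) := by
      refine Metric.cauchy_iff.2 ⟨inferInstance, fun ε hε => ?_⟩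
      set δ := ε / (C * M + 1) with hδ
      have hδ0 : 0 < δ := by positivity
      have hδε : C * M * δ < ε := by
        rw [hδ, mul_div_assoc', div_lt_iff₀ (by positivity)]
        nlinarith
      refine ⟨_, image_mem_map (inter_mem hmem (Ioo_mem_nhdsLT (sub_lt_self τ hδ0))), ?_⟩
      have h5 : ∀ r s, r ∈ Ico 0 τ ∩ Ioo (τ - δ) τ → s ∈ Ico 0 τ ∩ Ioo (τ - δ) τ → r ≤ s →
          dist ((φ ∘ γ) r) ((φ ∘ γ) s) < ε := by
        intro r s hr hs hrs
        rw [dist_comm, dist_eq_norm]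
        refine (hl r s hr.1.1 hrs hs.1.2).trans_lt (lt_of_le_of_lt ?_ hδε)
        have := hr.2.1
        have := hs.2.2
        gcongr
        linarith
      rintro _ ⟨r, hr, rfl⟩ _ ⟨s, hs, rfl⟩
      rcases le_total r s with h | h
      · exact h5 r s hr hs h
      · rw [dist_comm]
        exact h5 s r hs hr h
    obtain ⟨q, hq⟩ := CompleteSpace.complete hcauchy
    have hq' : Tendsto (φ ∘ γ) (𝓝[<] τ) (𝓝 q) := hq
    have hqn : ‖q - φ (γ 0)‖ ≤ C * M := by
      refine le_of_tendsto (hq'.sub_const (φ (γ 0))).norm ?_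
      filter_upwards [hmem] with r hr
      refine (hl 0 r le_rfl hr.1 hr.2).trans ?_
      have := hr.2.le.trans ht1.2
      nlinarith
    have hqR : q ∈ Metric.ball q₀ R := by
      rw [mem_ball_iff_norm]
      have := norm_add_le (q - φ (γ 0)) (φ (γ 0) - q₀)
      rw [sub_add_sub_cancel] at this
      linarith
    have h6 : Tendsto γ (𝓝[<] τ) (𝓝 (φ.symm q)) := by
      refine (((φ.symm.continuousAt (hR hqR)).tendsto.comp hq')).congr' ?_
      filter_upwards [hmem] with r hr using φ.left_inv (hlt r hr.1 hr.2).1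
    have h7 : γ τ = φ.symm q :=
      tendsto_nhds_unique ((hcont τ ht1).tendsto.mono_left nhdsWithin_le_nhds) h6
    rw [h7]
    exact ⟨φ.map_target (hR hqR), by rwa [mem_preimage, φ.right_inv (hR hqR)]⟩
  have hall : Icc (0 : ℝ) 1 ⊆ S := by
    refine hclosed.Icc_subset_of_forall_mem_nhdsWithin (fun τ hτ => ?_) fun t ht => ?_
    · rwa [le_antisymm hτ.2 hτ.1]
    · have h1 : γ ⁻¹' N ∈ 𝓝 t := (hcont t (Ico_subset_Icc_self ht.2)).preimage_mem_nhds
        (hNo.mem_nhds (ht.1 t ⟨ht.2.1, le_rfl⟩))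
      obtain ⟨l, u, hlu, h2⟩ := mem_nhds_iff_exists_Ioo_subset.1 h1
      filter_upwards [Ioo_mem_nhdsGT hlu.2] with s hs τ hτ
      rcases le_or_gt τ t with h | h
      · exact ht.1 τ ⟨hτ.1, h⟩
      · exact h2 ⟨hlu.1.trans h, hτ.2.trans_lt hs.2⟩
  have h1 := hall (right_mem_Icc.2 zero_le_one)
  have h2 := h1 1 (right_mem_Icc.2 zero_le_one)
  refine ⟨h2.1, h2.2, ?_⟩
  simpa using hlip 0 1 le_rfl zero_le_one le_rfl h1

/-- `f` increases by at most `M` along the curves of speed at most `M`. -/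
def IsMetricContraction (g : StrongMetric E X) (f : X → ℝ) : Prop :=
  ∀ (γ : ℝ → X) (M : ℝ), 0 ≤ M → HasSpeedLE g γ M → f (γ 1) - f (γ 0) ≤ M

open scoped ENNReal

/-- The distance defined by a metric, as the largest variation of the functions that contract the
lengths of curves. This dual form of the infimum of the lengths makes the triangle inequality
immediate. -/
def metricDist (g : StrongMetric E X) (x y : X) : ℝ≥0∞ :=
  ⨆ (f : X → ℝ) (_ : IsMetricContraction g f), edist (f x) (f y)

theorem edist_le_metricDist {g : StrongMetric E X} {f : X → ℝ} (hf : IsMetricContraction g f)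
    (x y : X) : edist (f x) (f y) ≤ metricDist g x y :=
  le_iSup₂ (f := fun (f : X → ℝ) (_ : IsMetricContraction g f) => edist (f x) (f y)) f hf

theorem metricDist_self (g : StrongMetric E X) (x : X) : metricDist g x x = 0 := by
  simp [metricDist]

theorem metricDist_comm (g : StrongMetric E X) (x y : X) : metricDist g x y = metricDist g y x := by
  simp only [metricDist, edist_comm]

theorem metricDist_triangle (g : StrongMetric E X) (x y z : X) :
    metricDist g x z ≤ metricDist g x y + metricDist g y z :=
  iSup₂_le fun f hf => (edist_triangle _ (f y) _).trans
    (add_le_add (edist_le_metricDist hf x y) (edist_le_metricDist hf y z))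

theorem eventually_metricDist_lt (g : StrongMetric E X) (x : X) {c : ℝ≥0∞} (hc : 0 < c) :
    ∀ᶠ y in 𝓝 x, metricDist g x y < c := by
  set φ := chartAt E x with hφ
  have hφm : φ ∈ Atlas∞ := chartAt_mem_maximalAtlas x
  have hx : x ∈ φ.source := mem_chart_source E x
  obtain ⟨C, hC0, hC⟩ := eventually_chartMetric_le g hφm (φ.map_source hx)
  obtain ⟨R, hR0, hR⟩ := Metric.mem_nhds_iff.1
    (inter_mem hC (φ.open_target.mem_nhds (φ.map_source hx)))
  have hb : ∀ᶠ y in 𝓝 x, φ y ∈ Metric.ball (φ x) R :=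
    (φ.continuousAt hx).eventually (Metric.ball_mem_nhds _ hR0)
  have hlim : Tendsto (fun y => ENNReal.ofReal (C * ‖φ y - φ x‖)) (𝓝 x) (𝓝 0) := by
    have h1 : ContinuousAt (fun y => C * ‖φ y - φ x‖) x :=
      ((φ.continuousAt hx).sub continuousAt_const).norm.const_mul C
    simpa using ENNReal.tendsto_ofReal h1.tendsto
  filter_upwards [hb, φ.open_source.mem_nhds hx, hlim.eventually (gt_mem_nhds hc)] with y hy hys hyc
  refine (iSup₂_le fun f hf => ?_).trans_lt hyc
  have key : ∀ q ∈ Metric.ball (φ x) R, ∀ q' ∈ Metric.ball (φ x) R,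
      f (φ.symm q') - f (φ.symm q) ≤ C * ‖q' - q‖ := by
    intro q hq q' hq'
    have h1 := hasSpeedLE_segment g hφm (fun _ h => (hR h).2) (fun _ h => (hR h).1) hq hq'
    have h2 := hf _ _ (by positivity) h1
    simpa using h2
  have h1 := key _ (Metric.mem_ball_self hR0) _ hy
  have h2 := key _ hy _ (Metric.mem_ball_self hR0)
  rw [φ.left_inv hx, φ.left_inv hys] at h1 h2
  rw [norm_sub_rev] at h2
  rw [edist_dist, Real.dist_eq]
  exact ENNReal.ofReal_le_ofReal (abs_le.2 ⟨by linarith, by linarith⟩)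

/-- Small balls of the distance are contained in a given neighborhood of their center. -/
theorem exists_metricDist_lt_subset [T2Space X] [CompleteSpace E] (g : StrongMetric E X) {x : X}
    {s : Set X} (hs : s ∈ 𝓝 x) : ∃ c > 0, {y | metricDist g x y < c} ⊆ s := by
  classical
  set φ := chartAt E x with hφ
  have hφm : φ ∈ Atlas∞ := chartAt_mem_maximalAtlas x
  have hx : x ∈ φ.source := mem_chart_source E x
  obtain ⟨C, hC0, hC⟩ := eventually_norm_sq_le_chartMetric g hφm (φ.map_source hx)
  have hs' : φ.symm ⁻¹' s ∈ 𝓝 (φ x) :=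
    (φ.symm.continuousAt (φ.map_source hx)).preimage_mem_nhds (by rwa [φ.left_inv hx])
  obtain ⟨R, hR0, hR⟩ := Metric.mem_nhds_iff.1
    (inter_mem (inter_mem hC hs') (φ.open_target.mem_nhds (φ.map_source hx)))
  set N : Set X := φ.source ∩ φ ⁻¹' Metric.ball (φ x) R with hN
  -- the distance from `x` in the chart, truncated, contracts the lengths of curves
  set f : X → ℝ := fun z => if z ∈ N then ‖φ z - φ x‖ / C else R / C with hf
  have hfR : ∀ z, f z ≤ R / C := by
    intro z
    by_cases hz : z ∈ N
    · rw [hf]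
      simp only [if_pos hz]
      have h1 : ‖φ z - φ x‖ < R := mem_ball_iff_norm.1 hz.2
      gcongr
    · rw [hf]
      simp only [if_neg hz, le_refl]
  have hfc : IsMetricContraction g f := by
    intro γ M hM hγ
    by_cases h0 : γ 0 ∈ N
    swap
    · have h1 : f (γ 0) = R / C := if_neg h0
      linarith [hfR (γ 1)]
    have h1 : f (γ 0) = ‖φ (γ 0) - φ x‖ / C := if_pos h0
    by_cases hlt : ‖φ (γ 0) - φ x‖ + C * M < R
    · obtain ⟨h2, h3, h4⟩ := hγ.mem_ball hφm (fun _ h => (hR h).2) hC0 hM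
        (fun _ h => (hR h).1.1) h0.1 hlt
      have h5 : f (γ 1) = ‖φ (γ 1) - φ x‖ / C := if_pos ⟨h2, h3⟩
      have h6 := norm_add_le (φ (γ 1) - φ (γ 0)) (φ (γ 0) - φ x)
      rw [sub_add_sub_cancel] at h6
      rw [h1, h5, ← sub_div, div_le_iff₀ hC0]
      linarith
    · have h2 : R / C ≤ ‖φ (γ 0) - φ x‖ / C + M := by
        rw [div_add' _ _ _ hC0.ne']
        gcongr
        linarith
      linarith [hfR (γ 1)]
  refine ⟨ENNReal.ofReal (R / C), ENNReal.ofReal_pos.2 (by positivity), fun y hy => ?_⟩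
  by_contra hys
  have hyN : y ∉ N := fun h => hys <| by
    have := (hR h.2).1.2
    rwa [mem_preimage, φ.left_inv h.1] at this
  have h1 : f y = R / C := if_neg hyN
  have h2 : f x = 0 := by
    have : x ∈ N := ⟨hx, Metric.mem_ball_self hR0⟩
    rw [hf]
    simp only [if_pos this]
    simp
  have h3 := (edist_le_metricDist hfc x y).trans_lt hy
  rw [h1, h2, edist_dist, dist_zero_left, Real.norm_of_nonneg (by positivity)] at h3
  exact lt_irrefl _ h3

/-- The distance defined by a strong metric on a Hausdorff manifold induces the topology. -/
theorem hasBasis_nhds_metricDist [T2Space X] [CompleteSpace E] (g : StrongMetric E X) (x : X) :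
    (𝓝 x).HasBasis (fun c : ℝ≥0∞ => 0 < c) (fun c => {y | metricDist g x y < c}) :=
  (basis_sets (𝓝 x)).to_hasBasis' (fun _ hs => exists_metricDist_lt_subset g hs)
    (fun _ hc => eventually_metricDist_lt g x hc)

theorem continuous_metricDist [T2Space X] [CompleteSpace E] (g : StrongMetric E X) :
    Continuous fun p : X × X => metricDist g p.1 p.2 :=
  letI := PseudoEMetricSpace.ofEDistOfTopology (metricDist g) (metricDist_self g)
    (metricDist_comm g) (metricDist_triangle g) (hasBasis_nhds_metricDist g)
  continuous_edist

theorem metricDist_smul_le {G : Type*} [Group G] [MulAction G X] {g : StrongMetric E X}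
    (hG : ActsBySmoothIsometries G g) (a : G) (x y : X) :
    metricDist g (a • x) (a • y) ≤ metricDist g x y := by
  refine iSup₂_le fun f hf => ?_
  refine edist_le_metricDist (f := fun z => f (a • z)) (fun γ M hM hγ => ?_) x y
  refine hf (fun t => a • γ t) M hM fun t ht => ?_
  obtain ⟨h1, h2⟩ := hγ t ht
  have h3 := ((hG a).1.mdifferentiableAt (x := γ t) (by simp)).hasMFDerivAt.comp t h1.hasMFDerivAt
  refine ⟨h3.mdifferentiableAt, ?_⟩
  have h4 : curveVel (fun t => a • γ t) t = selfDeriv (fun z : X => a • z) (γ t) (curveVel γ t) :=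
    congrArg (fun L : ℝ →L[ℝ] E => L 1) h3.mfderiv
  rw [h4]
  exact ((hG a).2 (γ t) (curveVel (E := E) γ t) (curveVel (E := E) γ t)).trans_le h2

theorem metricDist_smul {G : Type*} [Group G] [MulAction G X] {g : StrongMetric E X}
    (hG : ActsBySmoothIsometries G g) (a : G) (x y : X) :
    metricDist g (a • x) (a • y) = metricDist g x y := by
  refine le_antisymm (metricDist_smul_le hG a x y) ?_
  simpa using metricDist_smul_le hG a⁻¹ (a • x) (a • y)

end MetricDist

/-! ### Local tubes -/

section NormalDefect

variable {E : Type*} [NormedAddCommGroup E] [InnerProductSpace ℝ E] [CompleteSpace E]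

/-- The Riesz representation of linear forms, as a continuous linear map. -/
def rieszCLM : (E →L[ℝ] ℝ) →L[ℝ] E :=
  LinearMap.mkContinuous
    { toFun := fun L => (InnerProductSpace.toDual ℝ E).symm L
      map_add' := fun L L' => map_add _ L L'
      map_smul' := fun c L => by simp } 1 fun L => by simp

theorem inner_rieszCLM (L : E →L[ℝ] ℝ) (w : E) : inner ℝ (rieszCLM L) w = L w :=
  InnerProductSpace.toDual_symm_apply

variable (F : Submodule ℝ E) [F.HasOrthogonalProjection]

theorem starProjection_rieszCLM_eq_zero_iff (L : E →L[ℝ] ℝ) :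
    F.starProjection (rieszCLM L) = 0 ↔ ∀ u ∈ F, L u = 0 := by
  rw [Submodule.starProjection_apply_eq_zero_iff, Submodule.mem_orthogonal']
  simp only [inner_rieszCLM]

omit [CompleteSpace E] in
theorem starProjection_orthogonal_eq_zero_iff (v : E) : Fᗮ.starProjection v = 0 ↔ v ∈ F := by
  rw [Submodule.starProjection_apply_eq_zero_iff, Submodule.orthogonal_orthogonal]

omit [CompleteSpace E] in
theorem starProjection_orthogonal_add_eq_zero_iff (v w : E) :
    Fᗮ.starProjection v + F.starProjection w = 0 ↔
      Fᗮ.starProjection v = 0 ∧ F.starProjection w = 0 := by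
  refine ⟨fun h => ?_, fun h => by rw [h.1, h.2, add_zero]⟩
  have h1 := congrArg F.starProjection h
  rw [map_add, map_zero, (Submodule.starProjection_apply_eq_zero_iff F).2
    (Submodule.starProjection_apply_mem _ _), zero_add,
    Submodule.starProjection_eq_self_iff.2 (Submodule.starProjection_apply_mem _ _)] at h1
  rw [h1, add_zero] at h
  exact ⟨h, h1⟩

/-- The function that defines the normal bundle of the affine subspace `q₀ + F` for the metric `G`
as a submanifold of the tangent bundle: its component in the orthogonal complement of `F` vanishes
at the vectors with base point in `q₀ + F`, and its component in `F` at the vectors that are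
`G`-orthogonal to `F`. -/
def normalDefect (G : E → E →L[ℝ] E →L[ℝ] ℝ) (q₀ : E) (z : E × E) : E :=
  Fᗮ.starProjection (z.1 - q₀) + F.starProjection (rieszCLM (G z.1 z.2))

theorem normalDefect_eq_zero_iff (G : E → E →L[ℝ] E →L[ℝ] ℝ) (q₀ : E) (z : E × E) :
    normalDefect F G q₀ z = 0 ↔ z.1 - q₀ ∈ F ∧ ∀ u ∈ F, G z.1 z.2 u = 0 := by
  rw [normalDefect, starProjection_orthogonal_add_eq_zero_iff,
    starProjection_orthogonal_eq_zero_iff, starProjection_rieszCLM_eq_zero_iff]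

theorem contDiffOn_normalDefect {G : E → E →L[ℝ] E →L[ℝ] ℝ} {U : Set E} (hG : ContDiffOn ℝ ∞ G U)
    (q₀ : E) : ContDiffOn ℝ ∞ (normalDefect F G q₀) (U ×ˢ univ) := by
  have h1 : ContDiffOn ℝ ∞ (fun z : E × E => G z.1) (U ×ˢ univ) :=
    hG.comp contDiff_fst.contDiffOn fun _ hz => hz.1
  exact ((Fᗮ.starProjection.contDiff.comp (contDiff_fst.sub contDiff_const)).contDiffOn).add
    (F.starProjection.contDiff.comp_contDiffOn
      (rieszCLM.contDiff.comp_contDiffOn (h1.clm_apply contDiff_snd.contDiffOn)))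

/-- The derivative of `normalDefect` at the zero vector at `q₀`. -/
def normalDefectDeriv (B : E →L[ℝ] E →L[ℝ] ℝ) : E × E →L[ℝ] E :=
  Fᗮ.starProjection.comp (ContinuousLinearMap.fst ℝ E E) +
    F.starProjection.comp (rieszCLM.comp (B.comp (ContinuousLinearMap.snd ℝ E E)))

theorem hasFDerivAt_normalDefect {G : E → E →L[ℝ] E →L[ℝ] ℝ} {q₀ : E}
    (hG : DifferentiableAt ℝ G q₀) :
    HasFDerivAt (normalDefect F G q₀) (normalDefectDeriv F (G q₀)) (q₀, 0) := by
  have h1 : HasFDerivAt (fun z : E × E => G z.1)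
      ((fderiv ℝ G q₀).comp (ContinuousLinearMap.fst ℝ E E)) (q₀, 0) :=
    HasFDerivAt.comp (q₀, (0 : E)) hG.hasFDerivAt hasFDerivAt_fst
  have h2 := h1.clm_apply (hasFDerivAt_snd (𝕜 := ℝ) (p := (q₀, (0 : E))))
  have h3 := (Fᗮ.starProjection.hasFDerivAt.comp (q₀, (0 : E))
    ((hasFDerivAt_fst (𝕜 := ℝ) (p := (q₀, (0 : E)))).sub_const q₀)).add
    (F.starProjection.hasFDerivAt.comp (q₀, (0 : E)) (rieszCLM.hasFDerivAt.comp (q₀, (0 : E)) h2))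
  refine h3.congr_fderiv ?_
  refine ContinuousLinearMap.ext fun w => ?_
  simp [normalDefectDeriv]

/-- For a coercive form, the normal space of `F` is a complement of `F`. Together with the sum of
position and velocity, the derivative of `normalDefect` is therefore bijective. -/
theorem bijective_prod_normalDefectDeriv {B : E →L[ℝ] E →L[ℝ] ℝ} {C : ℝ} (hC0 : 0 < C)
    (hC : ∀ a, ‖a‖ ^ 2 ≤ C * B a a) :
    Function.Bijective (((ContinuousLinearMap.fst ℝ E E + ContinuousLinearMap.snd ℝ E E).prod
      (normalDefectDeriv F B) : E × E →L[ℝ] E × E)) := by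
  have happ : ∀ a b : E, ((ContinuousLinearMap.fst ℝ E E + ContinuousLinearMap.snd ℝ E E).prod
      (normalDefectDeriv F B)) (a, b) =
        (a + b, Fᗮ.starProjection a + F.starProjection (rieszCLM (B b))) := fun a b => rfl
  constructor
  · refine (injective_iff_map_eq_zero _).2 fun z hz => ?_
    obtain ⟨a, b⟩ := z
    rw [happ, Prod.mk_eq_zero, starProjection_orthogonal_add_eq_zero_iff,
      starProjection_orthogonal_eq_zero_iff, starProjection_rieszCLM_eq_zero_iff] at hz
    obtain ⟨h1, h2, h3⟩ := hz
    have hb : b ∈ F := by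
      rw [eq_neg_of_add_eq_zero_right h1]
      exact F.neg_mem h2
    have h4 := hC b
    rw [h3 b hb, mul_zero] at h4
    have hb0 : b = 0 := by
      rw [← norm_eq_zero]
      exact pow_eq_zero_iff two_ne_zero |>.1 (le_antisymm h4 (sq_nonneg _))
    rw [hb0, add_zero] at h1
    rw [hb0, h1]
    rfl
  · rintro ⟨c, d⟩
    have hFc : CompleteSpace F := by
      have : IsClosed (F : Set E) := by
        rw [← Submodule.orthogonal_orthogonal F]
        exact Submodule.isClosed_orthogonal _
      exact this.completeSpace_coe
    -- the component of `b` in the orthogonal complement of `F` is determined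
    set b₁ : E := Fᗮ.starProjection (c - d) with hb₁
    let BF : F →L[ℝ] F →L[ℝ] ℝ := B.bilinearComp F.subtypeL F.subtypeL
    have hco : IsCoercive BF := by
      refine ⟨C⁻¹, by positivity, fun v => ?_⟩
      rw [mul_assoc, ← sq, inv_mul_le_iff₀ hC0]
      exact hC v
    let L : F →L[ℝ] ℝ := (innerSL ℝ d - B b₁).comp F.subtypeL
    obtain ⟨b₂, hb₂⟩ := hco.continuousLinearEquivOfBilin.surjective (rieszCLM L)
    have hb₂' : ∀ w : F, B b₂ w = inner ℝ d (w : E) - B b₁ w := fun w => by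
      have h := hco.continuousLinearEquivOfBilin_apply b₂ w
      rw [hb₂, inner_rieszCLM] at h
      exact h.symm
    refine ⟨(c - (b₁ + b₂), b₁ + b₂), ?_⟩
    rw [happ]
    refine Prod.ext (sub_add_cancel _ _) ?_
    have h1 : F.starProjection (rieszCLM (B (b₁ + b₂))) = F.starProjection d := by
      rw [← sub_eq_zero, ← map_sub, Submodule.starProjection_apply_eq_zero_iff,
        Submodule.mem_orthogonal']
      intro u hu
      have h2 := hb₂' ⟨u, hu⟩
      rw [inner_sub_left, inner_rieszCLM, map_add]
      show B b₁ u + B b₂ u - _ = 0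
      rw [h2]
      ring
    have h2 : Fᗮ.starProjection (c - (b₁ + b₂)) = Fᗮ.starProjection d := by
      have h3 : Fᗮ.starProjection (b₂ : E) = 0 :=
        (starProjection_orthogonal_eq_zero_iff F _).2 b₂.2
      have h4 : Fᗮ.starProjection b₁ = b₁ :=
        Submodule.starProjection_eq_self_iff.2 (Submodule.starProjection_apply_mem _ _)
      rw [map_sub, map_add, h3, h4, hb₁, map_sub, add_zero, sub_sub_cancel]
    show Fᗮ.starProjection _ + _ = d
    rw [h1, h2, add_comm, Submodule.starProjection_add_starProjection_orthogonal]

end NormalDefect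

section LocalTube

variable {E : Type*} [NormedAddCommGroup E] [InnerProductSpace ℝ E] [CompleteSpace E]
  {X : Type*} [TopologicalSpace X] [ChartedSpace E X] [IsManifold 𝓘(ℝ, E) ∞ X]

local notation "TX" => TangentBundle 𝓘(ℝ, E) X
local notation "Atlas∞" => IsManifold.maximalAtlas 𝓘(ℝ, E) ∞ X

variable {φ : OpenPartialHomeomorph X E}

/-- In a chart in which `Y` is a closed affine subspace, the tangent vectors of `Y` are the vectors
in the direction of that subspace. -/
theorem mem_tangentSet_iff (hφ : φ ∈ Atlas∞) {Y : Set X} {q₀ : E} {F : Submodule ℝ E}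
    (hF : IsClosed (F : Set E)) (hY : ∀ x ∈ φ.source, x ∈ Y ↔ φ x - q₀ ∈ F) {p : TX}
    (hp : p.1 ∈ φ.source) (hpY : p.1 ∈ Y) :
    p ∈ tangentSet E Y ↔ chartDeriv φ p.1 p.2 ∈ F := by
  have hFc : CompleteSpace F := hF.completeSpace_coe
  constructor
  · rintro ⟨γ, hγ, hγY, rfl⟩
    have hp' : γ 0 ∈ φ.source := hp
    have h1 := hasDerivAt_chart_comp hφ (hγ.mdifferentiableAt (by simp)) hp'
    have h2 := (Fᗮ.starProjection.hasFDerivAt (x := φ (γ 0) - q₀)).comp_hasDerivAt (0 : ℝ)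
      (h1.sub_const q₀)
    have h3 : (Fᗮ.starProjection : E → E) ∘ (fun t => (φ ∘ γ) t - q₀) =ᶠ[𝓝 0] fun _ => 0 := by
      filter_upwards [hγY, hγ.continuousAt.eventually (φ.open_source.mem_nhds hp')] with t ht ht'
      exact (starProjection_orthogonal_eq_zero_iff F _).2 ((hY _ ht').1 ht)
    exact (starProjection_orthogonal_eq_zero_iff F _).1
      (h2.unique ((hasDerivAt_const (0 : ℝ) (0 : E)).congr_of_eventuallyEq h3))
  · intro hv
    set u := chartDeriv φ p.1 p.2 with hu
    set c : ℝ → E := fun t => φ p.1 + t • u with hc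
    have hc0 : c 0 = φ p.1 := by simp [hc]
    have hcd : HasDerivAt c u 0 := by
      have h := ((hasDerivAt_id (0 : ℝ)).smul_const u).const_add (φ p.1)
      rwa [one_smul] at h
    have hct : c 0 ∈ φ.target := hc0 ▸ φ.map_source hp
    have hcs : ContDiff ℝ ∞ c := contDiff_const.add (contDiff_id.smul contDiff_const)
    obtain ⟨-, h2⟩ := curveVel_chart_symm_comp hφ hcd hct
    refine ⟨φ.symm ∘ c, ?_, ?_, ?_⟩
    · exact ((contMDiffOn_symm_of_mem_maximalAtlas hφ).contMDiffAt
        (φ.open_target.mem_nhds hct)).comp (0 : ℝ) hcs.contMDiff.contMDiffAt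
    · filter_upwards [hcs.continuous.continuousAt.eventually (φ.open_target.mem_nhds hct)] with t ht
      refine (hY _ (φ.map_target ht)).2 ?_
      show φ (φ.symm (c t)) - q₀ ∈ F
      rw [φ.right_inv ht]
      show φ p.1 + t • u - q₀ ∈ F
      rw [add_sub_right_comm]
      exact F.add_mem ((hY _ hp).1 hpY) (F.smul_mem _ hv)
    · have h3 : (⟨(φ.symm ∘ c) 0, (curveVel (φ.symm ∘ c) 0 : E)⟩ : TX) =
          tangentChartSymm φ (c 0, u) := by
        rw [h2]
        rfl
      refine Eq.trans ?_ h3.symm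
      rw [hc0]
      exact (tangentChartSymm_tangentChart hφ hp).symm

theorem mem_normalBundle_iff (g : StrongMetric E X) (hφ : φ ∈ Atlas∞) {Y : Set X} {q₀ : E}
    {F : Submodule ℝ E} [F.HasOrthogonalProjection] (hF : IsClosed (F : Set E))
    (hY : ∀ x ∈ φ.source, x ∈ Y ↔ φ x - q₀ ∈ F) {p : TX} (hp : p.1 ∈ φ.source) :
    p ∈ normalBundle g Y ↔ normalDefect F (chartMetric g φ) q₀ (tangentChart φ p) = 0 := by
  rw [normalDefect_eq_zero_iff]
  refine Iff.trans (and_congr_left fun _ => hY _ hp) (and_congr_right fun hpF => ?_)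
  have hpY := (hY _ hp).2 hpF
  constructor
  · intro h u hu
    have h1 : chartDeriv φ p.1 (chartSymmDeriv φ (φ p.1) u) = u := by
      have := chartDeriv_chartSymmDeriv hφ (φ.map_source hp) u
      rwa [φ.left_inv hp] at this
    have h2 := h (chartSymmDeriv φ (φ p.1) u) ((mem_tangentSet_iff hφ hF hY
      (p := ⟨p.1, chartSymmDeriv φ (φ p.1) u⟩) hp hpY).2 (h1.symm ▸ hu))
    have h3 := metricAt_eq_chartMetric g hφ hp p.2 (chartSymmDeriv φ (φ p.1) u)
    rw [h1] at h3
    exact h3.symm.trans h2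
  · intro h w hw
    exact (metricAt_eq_chartMetric g hφ hp p.2 w).trans
      (h _ ((mem_tangentSet_iff hφ hF hY (p := ⟨p.1, w⟩) hp hpY).1 hw))

theorem riemannianExp_zero [T2Space X] (g : StrongMetric E X) (x : X) :
    riemannianExp g (⟨x, (0 : E)⟩ : TX) = x := by
  have hφ := chartAt_mem_maximalAtlas (E := E) x
  have hx := mem_chart_source E x
  obtain ⟨W, e, -, hqW, -, -, -, heq, hW⟩ :=
    exists_riemannianExp_tangentChartSymm g hφ ((chartAt E x).map_source hx)
  have h1 := (hW _ hqW).2.2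
  have h2 := tangentChartSymm_tangentChart hφ (p := (⟨x, (0 : E)⟩ : TX)) hx
  rw [tangentChart, show chartDeriv (chartAt E x) x (0 : E) = 0 from map_zero _] at h2
  rw [heq, h2, (chartAt E x).left_inv hx] at h1
  exact h1

/-- The exponential map restricts to a diffeomorphism from the open part `O` of the normal bundle
onto the open set `V`. -/
structure IsExpTube (g : StrongMetric E X) (Y : Set X) (O : Set TX) (V : Set X) : Prop where
  isOpen_source : IsOpen O
  isOpen_target : IsOpen V
  subset_expDomain : O ∩ normalBundle g Y ⊆ expDomain g
  isDiffeoOn : IsDiffeoOn (riemannianExp g) (O ∩ normalBundle g Y) V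

/-- By the inverse function theorem, applied to the pair of the exponential map and the defining
function of the normal bundle, there are local tubes around the zero vectors. -/
theorem exists_isExpTube [T2Space X] (g : StrongMetric E X) {Y : Set X}
    (hY : IsSmoothSubmanifold E Y) {y : X} (hy : y ∈ Y) :
    ∃ O V, (⟨y, (0 : E)⟩ : TX) ∈ O ∧ IsExpTube g Y O V := by
  obtain ⟨φ, hφ, hys, F, hF, hYF⟩ := hY y hy
  have hFc : CompleteSpace F := hF.completeSpace_coe
  have hyt := φ.map_source hys
  obtain ⟨W, e, hWo, hqW, hWt, he, hed, heq, hW⟩ := exists_riemannianExp_tangentChartSymm g hφ hyt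
  obtain ⟨C, hC0, hC⟩ := exists_norm_sq_le_of_isInvertible (chartMetric_symm g φ (φ y))
    (fun a ha => chartMetric_pos g hφ hyt ha) (isInvertible_chartMetric g hφ hyt)
  have hbij := bijective_prod_normalDefectDeriv F hC0 hC
  have hcm := contDiffOn_chartMetric g hφ
  have hΨ : ContDiffOn ℝ ∞ (fun z => (e z, normalDefect F (chartMetric g φ) (φ y) z)) W :=
    he.prodMk ((contDiffOn_normalDefect F hcm (φ y)).mono hWt)
  obtain ⟨Φ, hΦ0, hΦW, hΦ, hΦs⟩ := exists_openPartialHomeomorph_contDiffOn_symm hWo hqW hΨ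
    (ContinuousLinearEquiv.ofBijective _ (LinearMap.ker_eq_bot.2 hbij.1)
      (LinearMap.range_eq_top.2 hbij.2))
    (hed.prodMk (hasFDerivAt_normalDefect F
      ((hcm.contDiffAt (φ.open_target.mem_nhds hyt)).differentiableAt (by simp))))
  set O : Set TX := {p | p.1 ∈ φ.source ∧ tangentChart φ p ∈ Φ.source} with hO
  set V : Set X := φ.source ∩ φ ⁻¹' {q | (q, (0 : E)) ∈ Φ.target} with hV
  have hOo : IsOpen O := isOpen_tangentChart_preimage hφ Φ.open_source
  have hVo : IsOpen V := φ.isOpen_inter_preimage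
    (Φ.open_target.preimage (continuous_id.prodMk continuous_const))
  have hexp : ∀ p ∈ O, p ∈ expDomain g ∧ e (tangentChart φ p) ∈ φ.target ∧
      riemannianExp g p = φ.symm (e (tangentChart φ p)) := by
    intro p hp
    obtain ⟨h1, h2, h3⟩ := hW _ (hΦW hp.2)
    rw [tangentChartSymm_tangentChart hφ hp.1] at h2 h3
    exact ⟨h2, h1, h3⟩
  have hΦN : ∀ p ∈ O ∩ normalBundle g Y, Φ (tangentChart φ p) = (φ (riemannianExp g p), 0) := by
    intro p hp
    obtain ⟨-, h1, h2⟩ := hexp p hp.1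
    rw [hΦ, h2, φ.right_inv h1, (mem_normalBundle_iff g hφ hF hYF hp.1.1).1 hp.2]
  set ψ : X → TX := fun x => tangentChartSymm φ (Φ.symm (φ x, 0)) with hψ
  have hmaps : MapsTo (riemannianExp g) (O ∩ normalBundle g Y) V := by
    intro p hp
    obtain ⟨-, h1, h2⟩ := hexp p hp.1
    refine ⟨h2 ▸ φ.map_target h1, ?_⟩
    show (_, _) ∈ Φ.target
    rw [← hΦN p hp]
    exact Φ.map_source hp.1.2
  have hψm : MapsTo ψ V (O ∩ normalBundle g Y) := by
    intro x hx
    have h1 : Φ.symm (φ x, 0) ∈ Φ.source := Φ.map_target hx.2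
    have h2 : tangentChart φ (ψ x) = Φ.symm (φ x, 0) := tangentChart_symm hφ (hWt (hΦW h1)).1
    have h3 : (ψ x).1 ∈ φ.source := φ.map_target (hWt (hΦW h1)).1
    refine ⟨⟨h3, h2 ▸ h1⟩, (mem_normalBundle_iff g hφ hF hYF h3).2 ?_⟩
    rw [h2]
    have h4 := Φ.right_inv hx.2
    rw [hΦ] at h4
    exact congrArg Prod.snd h4
  have hleft : LeftInvOn ψ (riemannianExp g) (O ∩ normalBundle g Y) := by
    intro p hp
    rw [hψ]
    show tangentChartSymm φ (Φ.symm (φ (riemannianExp g p), 0)) = p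
    rw [← hΦN p hp, Φ.left_inv hp.1.2, tangentChartSymm_tangentChart hφ hp.1.1]
  have hright : RightInvOn ψ (riemannianExp g) V := by
    intro x hx
    have h1 : Φ.symm (φ x, 0) ∈ Φ.source := Φ.map_target hx.2
    have h2 : tangentChart φ (ψ x) = Φ.symm (φ x, 0) := tangentChart_symm hφ (hWt (hΦW h1)).1
    have h3 := hΦN _ (hψm hx)
    rw [h2, Φ.right_inv hx.2] at h3
    exact φ.injOn (hmaps (hψm hx)).1 hx.1 (congrArg Prod.fst h3).symm
  refine ⟨O, V, ⟨hys, ?_⟩, hOo, hVo, fun p hp => (hexp p hp.1).1,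
    BijOn.mk hmaps hleft.injOn (hright.surjOn hψm), ?_, ψ, ⟨hleft, hright⟩, ?_⟩
  · rw [tangentChart, show chartDeriv φ y (0 : E) = 0 from map_zero _]
    exact hΦ0
  · have h1 : ContMDiffOn (𝓘(ℝ, E)).tangent 𝓘(ℝ, E) ∞
        (fun p : TX => φ.symm (e (tangentChart φ p))) O :=
      (contMDiffOn_symm_of_mem_maximalAtlas hφ).comp
        (he.contMDiffOn.comp ((contMDiffOn_tangentChart hφ).mono fun p hp => hp.1)
          fun p hp => hΦW hp.2) fun p hp => (hexp p hp).2.1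
    exact (h1.congr fun p hp => (hexp p hp).2.2).mono inter_subset_left
  · refine (contMDiffOn_tangentChartSymm hφ).comp (hΦs.contMDiffOn.comp
      (t := Φ.target) (f := fun x : X => (φ x, (0 : E))) ?_ fun x hx => hx.2)
      fun x hx => hWt (hΦW (Φ.map_target hx.2))
    exact ((contMDiffOn_of_mem_maximalAtlas hφ).mono inter_subset_left).prodMk_space
      contMDiffOn_const

end LocalTube

/-! ### The group action on the normal bundle and on tubes -/

section NormalAction

open scoped ENNReal

variable {E : Type*} [NormedAddCommGroup E] [InnerProductSpace ℝ E]
  {X : Type*} [TopologicalSpace X] [ChartedSpace E X] [IsManifold 𝓘(ℝ, E) ∞ X]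

local notation "TX" => TangentBundle 𝓘(ℝ, E) X

/-- The square of the length of a tangent vector. -/
def tangentNormSq (g : StrongMetric E X) (p : TX) : ℝ := metricAt g p.1 p.2 p.2

theorem tangentNormSq_zero (g : StrongMetric E X) (x : X) :
    tangentNormSq g (⟨x, (0 : E)⟩ : TX) = 0 :=
  map_zero (metricAt g x 0)

theorem continuous_tangentNormSq (g : StrongMetric E X) : Continuous (tangentNormSq g) := by
  refine continuous_iff_continuousAt.2 fun p => ?_
  set φ := chartAt E p.1
  have hφ : φ ∈ IsManifold.maximalAtlas 𝓘(ℝ, E) ∞ X := chartAt_mem_maximalAtlas p.1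
  have hp : p.1 ∈ φ.source := mem_chart_source E p.1
  have hU : {p : TX | p.1 ∈ φ.source} ∈ 𝓝 p :=
    (φ.open_source.preimage continuous_tangentProj).mem_nhds hp
  have h1 : ContinuousAt (tangentChart φ) p :=
    (contMDiffOn_tangentChart hφ).continuousOn.continuousAt hU
  have h2 : ContinuousAt (fun p => chartMetric g φ (tangentChart φ p).1) p :=
    ContinuousAt.comp (f := fun p => (tangentChart φ p).1)
      ((contDiffOn_chartMetric g hφ).continuousOn.continuousAt
        (φ.open_target.mem_nhds (φ.map_source hp))) h1.fst
  refine ((h2.clm_apply h1.snd).clm_apply h1.snd).congr ?_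
  filter_upwards [hU] with r hr
  exact (metricAt_eq_chartMetric g hφ hr r.2 r.2).symm

variable {G : Type*} [Group G] [MulAction G X] {g : StrongMetric E X} {Y : Set X}

theorem tangentNormSq_tangentAct (hG : ActsBySmoothIsometries G g) (a : G) (p : TX) :
    tangentNormSq g (tangentAct E a p) = tangentNormSq g p :=
  (hG a).2 p.1 p.2 p.2

theorem tangentAct_mem_tangentSet (hG : ActsBySmoothIsometries G g)
    (hGY : ∀ a : G, ∀ y ∈ Y, a • y ∈ Y) (a : G) {p : TX} (hp : p ∈ tangentSet E Y) :
    tangentAct E a p ∈ tangentSet E Y := by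
  obtain ⟨γ, hγ, hγY, rfl⟩ := hp
  refine ⟨fun t => a • γ t, (hG a).1.contMDiffAt.comp (0 : ℝ) hγ,
    hγY.mono fun t ht => hGY a _ ht, ?_⟩
  have h := ((hG a).1.mdifferentiableAt (x := γ 0) (by simp)).hasMFDerivAt.comp (0 : ℝ)
    (hγ.mdifferentiableAt (by simp)).hasMFDerivAt
  exact congrArg (fun L : ℝ →L[ℝ] E => (⟨a • γ 0, L 1⟩ : TX)) h.mfderiv.symm

theorem tangentAct_mem_normalBundle (hG : ActsBySmoothIsometries G g)
    (hGY : ∀ a : G, ∀ y ∈ Y, a • y ∈ Y) (a : G) {p : TX} (hp : p ∈ normalBundle g Y) :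
    tangentAct E a p ∈ normalBundle g Y := by
  refine ⟨hGY a _ hp.1, fun w hw => ?_⟩
  obtain ⟨v, rfl⟩ := surjective_selfDeriv_smul hG a p.1 w
  have hw' : tangentAct E a (⟨p.1, v⟩ : TX) ∈ tangentSet E Y := hw
  have h1 := tangentAct_mem_tangentSet hG hGY a⁻¹ hw'
  rw [tangentAct_inv_tangentAct hG] at h1
  exact ((hG a).2 p.1 p.2 v).trans (hp.2 v h1)

variable [CompleteSpace E] [T2Space X]

/-- Isometries carry tubes to tubes. -/
theorem IsExpTube.preimage_tangentAct (hG : ActsBySmoothIsometries G g)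
    (hGY : ∀ a : G, ∀ y ∈ Y, a • y ∈ Y) (a : G) {O : Set TX} {V : Set X}
    (h : IsExpTube g Y O V) :
    IsExpTube g Y (tangentAct E a ⁻¹' O) ((fun x : X => a • x) ⁻¹' V) := by
  have hmem : ∀ p ∈ tangentAct E a ⁻¹' O ∩ normalBundle g Y,
      tangentAct E a p ∈ O ∩ normalBundle g Y :=
    fun p hp => ⟨hp.1, tangentAct_mem_normalBundle hG hGY a hp.2⟩
  have hmem' : ∀ p ∈ O ∩ normalBundle g Y,
      tangentAct E a⁻¹ p ∈ tangentAct E a ⁻¹' O ∩ normalBundle g Y := fun p hp =>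
    ⟨by rw [mem_preimage, tangentAct_tangentAct_inv hG]; exact hp.1,
      tangentAct_mem_normalBundle hG hGY a⁻¹ hp.2⟩
  have hdom : ∀ p ∈ tangentAct E a ⁻¹' O ∩ normalBundle g Y, p ∈ expDomain g := fun p hp => by
    have h1 := tangentAct_mem_expDomain hG a⁻¹ (h.subset_expDomain (hmem p hp))
    rwa [tangentAct_inv_tangentAct hG] at h1
  have hexp : ∀ p ∈ tangentAct E a ⁻¹' O ∩ normalBundle g Y,
      riemannianExp g p = a⁻¹ • riemannianExp g (tangentAct E a p) := fun p hp => by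
    rw [riemannianExp_tangentAct hG a (hdom p hp), inv_smul_smul]
  obtain ⟨hbij, hsm, ψ, hinv, hψ⟩ := h.isDiffeoOn
  have hψm : MapsTo ψ V (O ∩ normalBundle g Y) := fun x hx => by
    obtain ⟨p, hp, rfl⟩ := hbij.surjOn hx
    rwa [hinv.1 hp]
  have hleft : LeftInvOn (fun x : X => tangentAct E a⁻¹ (ψ (a • x))) (riemannianExp g)
      (tangentAct E a ⁻¹' O ∩ normalBundle g Y) := fun p hp => by
    show tangentAct E a⁻¹ (ψ (a • riemannianExp g p)) = p
    rw [hexp p hp, smul_inv_smul, hinv.1 (hmem p hp), tangentAct_inv_tangentAct hG]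
  have hright : RightInvOn (fun x : X => tangentAct E a⁻¹ (ψ (a • x))) (riemannianExp g)
      ((fun x : X => a • x) ⁻¹' V) := fun x hx => by
    show riemannianExp g (tangentAct E a⁻¹ (ψ (a • x))) = x
    rw [hexp _ (hmem' _ (hψm hx)), tangentAct_tangentAct_inv hG, hinv.2 hx, inv_smul_smul]
  refine ⟨h.isOpen_source.preimage (contMDiff_tangentAct hG a).continuous,
    h.isOpen_target.preimage (hG a).1.continuous, hdom,
    BijOn.mk (fun p hp => ?_) hleft.injOn (hright.surjOn fun x hx => hmem' _ (hψm hx)), ?_,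
    _, ⟨hleft, hright⟩, ?_⟩
  · rw [mem_preimage, hexp p hp, smul_inv_smul]
    exact hbij.mapsTo (hmem p hp)
  · exact ((hG a⁻¹).1.comp_contMDiffOn
      (hsm.comp (contMDiff_tangentAct hG a).contMDiffOn hmem)).congr hexp
  · exact (contMDiff_tangentAct hG a⁻¹).comp_contMDiffOn
      (hψ.comp (hG a).1.contMDiffOn fun x hx => hx)

/-! ### Radii of tubes -/

/-- The normal vectors of squared length less than `r` at the points at distance less than `r` from
`y` lie in a tube. -/
def IsTubeRadius (g : StrongMetric E X) (Y : Set X) (y : X) (r : ℝ≥0∞) : Prop :=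
  ∃ O V, IsExpTube g Y O V ∧ ∀ p ∈ normalBundle g Y, metricDist g y p.1 < r →
    ENNReal.ofReal (tangentNormSq g p) < r → p ∈ O

theorem exists_isTubeRadius (g : StrongMetric E X) (hY : IsSmoothSubmanifold E Y) {y : X}
    (hy : y ∈ Y) : ∃ r > 0, IsTubeRadius g Y y r := by
  obtain ⟨O, V, hyO, hOV⟩ := exists_isExpTube g hY hy
  set φ := chartAt E y
  have hφ : φ ∈ IsManifold.maximalAtlas 𝓘(ℝ, E) ∞ X := chartAt_mem_maximalAtlas y
  have hys : y ∈ φ.source := mem_chart_source E y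
  have hyt := φ.map_source hys
  have h1 : tangentChartSymm φ (φ y, 0) = (⟨y, (0 : E)⟩ : TX) := by
    have h := tangentChartSymm_tangentChart hφ (p := (⟨y, (0 : E)⟩ : TX)) hys
    rwa [tangentChart, show chartDeriv φ y (0 : E) = 0 from map_zero _] at h
  have h2 : (tangentChartSymm φ : E × E → TX) ⁻¹' O ∈ 𝓝 (φ y, (0 : E)) :=
    ((contMDiffOn_tangentChartSymm hφ).continuousOn.continuousAt
      ((φ.open_target.prod isOpen_univ).mem_nhds ⟨hyt, mem_univ _⟩)).preimage_mem_nhds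
      (h1 ▸ hOV.isOpen_source.mem_nhds hyO)
  obtain ⟨ρ, hρ, hρO⟩ := Metric.mem_nhds_iff.1 h2
  obtain ⟨C, hC0, hC⟩ := eventually_norm_sq_le_chartMetric g hφ hyt
  have hs : φ.source ∩ φ ⁻¹' (Metric.ball (φ y) ρ ∩
      {q | ∀ a, ‖a‖ ^ 2 ≤ C ^ 2 * chartMetric g φ q a a}) ∈ 𝓝 y :=
    inter_mem (φ.open_source.mem_nhds hys)
      ((φ.continuousAt hys).preimage_mem_nhds (inter_mem (Metric.ball_mem_nhds _ hρ) hC))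
  obtain ⟨c, hc0, hc⟩ := exists_metricDist_lt_subset g hs
  refine ⟨min c (ENNReal.ofReal ((ρ / C) ^ 2)),
    lt_min hc0 (ENNReal.ofReal_pos.2 (by positivity)), O, V, hOV, fun p _ hpd hpn => ?_⟩
  obtain ⟨hps, hpρ, hpC⟩ := hc (hpd.trans_le (min_le_left _ _))
  have h3 : tangentNormSq g p < (ρ / C) ^ 2 :=
    (ENNReal.ofReal_lt_ofReal_iff (by positivity)).1 (hpn.trans_le (min_le_right _ _))
  have h4 : ‖chartDeriv φ p.1 p.2‖ < ρ := by
    refine lt_of_pow_lt_pow_left₀ 2 hρ.le ((hpC _).trans_lt ?_)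
    have h5 : chartMetric g φ (φ p.1) (chartDeriv φ p.1 p.2) (chartDeriv φ p.1 p.2) =
        tangentNormSq g p := (metricAt_eq_chartMetric g hφ hps p.2 p.2).symm
    refine (congrArg (C ^ 2 * ·) h5).trans_lt ?_
    rw [div_pow, lt_div_iff₀ (by positivity), mul_comm] at h3
    exact h3
  rw [← tangentChartSymm_tangentChart hφ hps]
  refine hρO ?_
  rw [mem_ball_iff_norm, Prod.norm_def]
  refine max_lt (mem_ball_iff_norm.1 hpρ) ?_
  show ‖chartDeriv φ p.1 p.2 - 0‖ < ρ
  rwa [sub_zero]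

omit [T2Space X] in
theorem IsTubeRadius.of_add_le {y y' : X} {r s : ℝ≥0∞} (h : IsTubeRadius g Y y r)
    (hy : metricDist g y y' ≠ ⊤) (hs : metricDist g y y' + s ≤ r) : IsTubeRadius g Y y' s := by
  obtain ⟨O, V, hOV, hO⟩ := h
  refine ⟨O, V, hOV, fun p hp hd hn => hO p hp ?_ (hn.trans_le (le_add_self.trans hs))⟩
  exact (metricDist_triangle g y y' p.1).trans_lt
    (((ENNReal.add_lt_add_iff_left hy).2 hd).trans_le hs)

theorem IsTubeRadius.smul (hG : ActsBySmoothIsometries G g) (hGY : ∀ a : G, ∀ y ∈ Y, a • y ∈ Y)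
    (a : G) {y : X} {r : ℝ≥0∞} (h : IsTubeRadius g Y y r) : IsTubeRadius g Y (a • y) r := by
  obtain ⟨O, V, hOV, hO⟩ := h
  refine ⟨_, _, hOV.preimage_tangentAct hG hGY a⁻¹, fun p hp hd hn => ?_⟩
  refine hO _ (tangentAct_mem_normalBundle hG hGY a⁻¹ hp) ?_ ?_
  · rw [← metricDist_smul hG a, tangentAct_fst, smul_inv_smul]
    exact hd
  · rwa [tangentNormSq_tangentAct hG]

/-! ### The global tube -/

/-- The normal vectors that lie in a tube around their base point, of a radius that is large
compared with their length and with the distance between their base point and their image under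
the exponential map. -/
def tubeSource (g : StrongMetric E X) (Y : Set X) : Set TX :=
  {p | p ∈ normalBundle g Y ∧ ∃ r, IsTubeRadius g Y p.1 r ∧
    ENNReal.ofReal (tangentNormSq g p) < r ∧ 4 * metricDist g p.1 (riemannianExp g p) < r}

omit [T2Space X] in
theorem mem_of_mem_tubeSource {p : TX} (hp : p ∈ tubeSource g Y) :
    ∃ O V, IsExpTube g Y O V ∧ p ∈ O ∩ normalBundle g Y := by
  obtain ⟨hpN, r, ⟨O, V, hOV, hO⟩, hr, -⟩ := hp
  exact ⟨O, V, hOV, hO p hpN (by rw [metricDist_self]; exact zero_le.trans_lt hr) hr, hpN⟩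

omit [T2Space X] in
/-- Two normal vectors with the same image lie in the larger one of their tubes. -/
theorem injOn_riemannianExp_tubeSource : InjOn (riemannianExp g) (tubeSource g Y) := by
  have key : ∀ p ∈ tubeSource g Y, ∀ p' ∈ tubeSource g Y, riemannianExp g p = riemannianExp g p' →
      ∀ r r', r' ≤ r → IsTubeRadius g Y p.1 r → ENNReal.ofReal (tangentNormSq g p) < r →
      ENNReal.ofReal (tangentNormSq g p') < r' → 4 * metricDist g p.1 (riemannianExp g p) < r →
      4 * metricDist g p'.1 (riemannianExp g p') < r' → p = p' := by
    rintro p hp p' hp' he r r' hrr ⟨O, V, hOV, hO⟩ hn hn' hd hd'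
    have h1 : metricDist g p.1 p'.1 < r := by
      refine (metricDist_triangle g p.1 (riemannianExp g p) p'.1).trans_lt ?_
      rw [metricDist_comm g (riemannianExp g p) p'.1, he]
      rw [he] at hd
      have h2 : ∀ d d' : ℝ≥0∞, d ≤ d' → 4 * d' < r → d + d' < r := fun d d' hdd h =>
        lt_of_le_of_lt (by
          calc d + d' ≤ d' + d' := by gcongr
            _ = 2 * d' := (two_mul d').symm
            _ ≤ 4 * d' := by gcongr; norm_num) h
      rcases le_total (metricDist g p.1 (riemannianExp g p'))
        (metricDist g p'.1 (riemannianExp g p')) with h | h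
      · exact h2 _ _ h (hd'.trans_le hrr)
      · rw [add_comm]
        exact h2 _ _ h hd
    exact hOV.isDiffeoOn.1.injOn
      ⟨hO p hp.1 (by rw [metricDist_self]; exact zero_le.trans_lt hn) hn, hp.1⟩
      ⟨hO p' hp'.1 h1 (hn'.trans_le hrr), hp'.1⟩ he
  intro p hp p' hp' he
  obtain ⟨-, r, hr, hn, hd⟩ := id hp
  obtain ⟨-, r', hr', hn', hd'⟩ := id hp'
  rcases le_total r' r with h | h
  · exact key p hp p' hp' he r r' h hr hn hn' hd hd'
  · exact (key p' hp' p hp he.symm r' r h hr' hn' hn hd' hd).symm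

/-- The source of the global tube is relatively open in the normal bundle. -/
theorem exists_isOpen_inter_subset_tubeSource {p : TX} (hp : p ∈ tubeSource g Y) :
    ∃ O, IsOpen O ∧ p ∈ O ∧ O ∩ normalBundle g Y ⊆ tubeSource g Y := by
  obtain ⟨O, V, hOV, hpO⟩ := mem_of_mem_tubeSource hp
  obtain ⟨hpN, r, hr, hn, hd⟩ := hp
  obtain ⟨s, hs, hsr⟩ := exists_between (max_lt hn hd)
  have hexp : ContinuousWithinAt (riemannianExp g) (normalBundle g Y) p := by
    refine (hOV.isDiffeoOn.2.1.continuousOn p hpO).mono_of_mem_nhdsWithin ?_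
    exact inter_mem (mem_nhdsWithin_of_mem_nhds (hOV.isOpen_source.mem_nhds hpO.1))
      self_mem_nhdsWithin
  have hproj : ContinuousWithinAt (fun p : TX => p.1) (normalBundle g Y) p :=
    continuous_tangentProj.continuousWithinAt
  have h1 : ∀ᶠ p' in 𝓝[normalBundle g Y] p, metricDist g p.1 p'.1 < r - s :=
    hproj.eventually (eventually_metricDist_lt g p.1 (tsub_pos_of_lt hsr))
  have hnc : Continuous fun p' : TX => ENNReal.ofReal (tangentNormSq g p') :=
    ENNReal.continuous_ofReal.comp (continuous_tangentNormSq g)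
  have h2 : ∀ᶠ p' in 𝓝[normalBundle g Y] p, ENNReal.ofReal (tangentNormSq g p') < s :=
    hnc.continuousWithinAt.eventually (gt_mem_nhds ((le_max_left _ _).trans_lt hs))
  have hdc : Continuous fun q : X × X => 4 * metricDist g q.1 q.2 :=
    (ENNReal.continuous_const_mul (by simp)).comp (continuous_metricDist g)
  have h3 : ContinuousWithinAt (fun p' : TX => 4 * metricDist g p'.1 (riemannianExp g p'))
      (normalBundle g Y) p :=
    hdc.continuousAt.comp_continuousWithinAt (f := fun p' : TX => (p'.1, riemannianExp g p'))
      (hproj.prodMk hexp)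
  have h4 := h3.eventually (gt_mem_nhds ((le_max_right _ _).trans_lt hs))
  obtain ⟨O', hO', hpO', hsub⟩ := mem_nhdsWithin.1 ((h1.and (h2.and h4)).and self_mem_nhdsWithin)
  refine ⟨O', hO', hpO', fun p' hp' => ?_⟩
  obtain ⟨⟨h5, h6, h7⟩, h8⟩ := hsub hp'
  exact ⟨h8, s, hr.of_add_le h5.ne_top (lt_tsub_iff_right.1 h5).le, h6, h7⟩

theorem isOpenNhdOfZeroSection_tubeSource (hY : IsSmoothSubmanifold E Y) :
    IsOpenNhdOfZeroSection g Y (tubeSource g Y) := by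
  refine ⟨?_, fun y hy => ?_⟩
  · refine ⟨⋃₀ {O | IsOpen O ∧ O ∩ normalBundle g Y ⊆ tubeSource g Y},
      isOpen_sUnion fun O hO => hO.1, Subset.antisymm (fun p hp => ⟨?_, hp.1⟩) ?_⟩
    · obtain ⟨O, hO, hpO, hsub⟩ := exists_isOpen_inter_subset_tubeSource hp
      exact ⟨O, ⟨hO, hsub⟩, hpO⟩
    · rintro p ⟨⟨O, hO, hpO⟩, hpN⟩
      exact hO.2 ⟨hpO, hpN⟩
  · obtain ⟨r, hr0, hr⟩ := exists_isTubeRadius g hY hy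
    refine ⟨⟨hy, fun w _ => ?_⟩, r, hr, ?_, ?_⟩
    · exact congrArg (fun L : E →L[ℝ] ℝ => L w) (map_zero (metricAt g y))
    · refine (congrArg ENNReal.ofReal (tangentNormSq_zero g y)).trans_lt ?_
      rwa [ENNReal.ofReal_zero]
    · have h : metricDist g y (riemannianExp g (⟨y, (0 : E)⟩ : TX)) = 0 := by
        rw [riemannianExp_zero, metricDist_self]
      refine (congrArg (4 * ·) h).trans_lt ?_
      rwa [mul_zero]

omit [T2Space X] in
theorem tubeSource_subset : tubeSource g Y ⊆ expDomain g ∩ normalBundle g Y := fun p hp => by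
  obtain ⟨O, V, hOV, hpO⟩ := mem_of_mem_tubeSource hp
  exact ⟨hOV.subset_expDomain hpO, hp.1⟩

theorem tangentAct_mem_tubeSource (hG : ActsBySmoothIsometries G g)
    (hGY : ∀ a : G, ∀ y ∈ Y, a • y ∈ Y) (a : G) {p : TX} (hp : p ∈ tubeSource g Y) :
    tangentAct E a p ∈ tubeSource g Y := by
  have hdom := (tubeSource_subset hp).1
  obtain ⟨hpN, r, hr, hn, hd⟩ := hp
  refine ⟨tangentAct_mem_normalBundle hG hGY a hpN, r, hr.smul hG hGY a, ?_, ?_⟩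
  · rwa [tangentNormSq_tangentAct hG]
  · rwa [riemannianExp_tangentAct hG a hdom, tangentAct_fst, metricDist_smul hG]

/-- Around the image of each vector of the global tube, the inverse of the exponential map is
the one of a local tube. -/
theorem exists_local_inverse_riemannianExp {p : TX} (hp : p ∈ tubeSource g Y) :
    ∃ (T : Set X) (ψ : X → TX), IsOpen T ∧ riemannianExp g p ∈ T ∧
      ContMDiffOn 𝓘(ℝ, E) (𝓘(ℝ, E)).tangent ∞ ψ T ∧
      ∀ x ∈ T, ψ x ∈ tubeSource g Y ∧ riemannianExp g (ψ x) = x := by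
  obtain ⟨O, V, hOV, hpO⟩ := mem_of_mem_tubeSource hp
  obtain ⟨O', hO', hpO', hsub⟩ := exists_isOpen_inter_subset_tubeSource hp
  obtain ⟨hbij, -, ψ, hinv, hψ⟩ := hOV.isDiffeoOn
  refine ⟨V ∩ ψ ⁻¹' O', ψ, hψ.continuousOn.isOpen_inter_preimage hOV.isOpen_target hO',
    ⟨hbij.mapsTo hpO, ?_⟩, hψ.mono inter_subset_left, fun x hx => ⟨?_, hinv.2 hx.1⟩⟩
  · rwa [mem_preimage, hinv.1 hpO]
  · obtain ⟨p', hp', rfl⟩ := hbij.surjOn hx.1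
    have h1 := hx.2
    rw [mem_preimage, hinv.1 hp'] at h1
    rw [hinv.1 hp']
    exact hsub ⟨h1, hp'.2⟩

theorem isOpen_image_tubeSource : IsOpen (riemannianExp g '' tubeSource g Y) := by
  refine isOpen_iff_mem_nhds.2 ?_
  rintro _ ⟨p, hp, rfl⟩
  obtain ⟨T, ψ, hT, hpT, -, hψ⟩ := exists_local_inverse_riemannianExp hp
  exact mem_of_superset (hT.mem_nhds hpT) fun x hx => ⟨ψ x, hψ x hx⟩

theorem isDiffeoOn_tubeSource :
    IsDiffeoOn (riemannianExp g) (tubeSource g Y) (riemannianExp g '' tubeSource g Y) := by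
  have hinj : InjOn (riemannianExp g) (tubeSource g Y) := injOn_riemannianExp_tubeSource
  refine ⟨hinj.bijOn_image, fun p hp => ?_, ?_⟩
  · obtain ⟨O, V, hOV, hpO⟩ := mem_of_mem_tubeSource hp
    refine (hOV.isDiffeoOn.2.1 p hpO).mono_of_mem_nhdsWithin ?_
    filter_upwards [self_mem_nhdsWithin,
      mem_nhdsWithin_of_mem_nhds (hOV.isOpen_source.mem_nhds hpO.1)] with p' h1 h2 using ⟨h2, h1.1⟩
  · by_cases hne : (tubeSource g Y).Nonempty
    swap
    · rw [not_nonempty_iff_eq_empty.1 hne, image_empty]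
      exact ⟨fun x => ⟨x, (0 : E)⟩, ⟨fun _ h => h.elim, fun _ h => h.elim⟩, fun _ h => h.elim⟩
    have : Nonempty TX := hne.to_type
    have hinv := hinj.bijOn_image.invOn_invFunOn
    refine ⟨Function.invFunOn (riemannianExp g) (tubeSource g Y), hinv, ?_⟩
    rintro _ ⟨p, hp, rfl⟩
    obtain ⟨T, ψ, hT, hpT, hψs, hψ⟩ := exists_local_inverse_riemannianExp hp
    refine ((hψs.contMDiffAt (hT.mem_nhds hpT)).congr_of_eventuallyEq ?_).contMDiffWithinAt
    filter_upwards [hT.mem_nhds hpT] with x hx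
    have h1 := hinv.1 (hψ x hx).1
    rwa [(hψ x hx).2] at h1

end NormalAction

end

theorem proposition2p3
    {E : Type*} [NormedAddCommGroup E] [InnerProductSpace ℝ E] [CompleteSpace E]
    {X : Type*} [TopologicalSpace X] [T2Space X] [ChartedSpace E X] [IsManifold 𝓘(ℝ, E) ∞ X]
    (g : StrongMetric E X)
    {G : Type*} [Group G] [MulAction G X] (hG : ActsBySmoothIsometries G g)
    (Y : Set X) (hY : IsSmoothSubmanifold E Y) (hGY : ∀ a : G, ∀ y ∈ Y, a • y ∈ Y)
    (hN : IsSmoothSubbundleOver Y (normalBundle g Y)) :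
    ∃ (Z : Set (TangentBundle 𝓘(ℝ, E) X)) (V : Set X),
      IsOpenNhdOfZeroSection g Y Z ∧
      Z ⊆ expDomain g ∩ normalBundle g Y ∧
      (∀ a : G, tangentAct E a '' Z = Z) ∧
      IsOpen V ∧ Y ⊆ V ∧
      IsDiffeoOn (riemannianExp g) Z V ∧
      (∀ a : G, ∀ p ∈ Z, riemannianExp g (tangentAct E a p) = a • riemannianExp g p) ∧
      (∀ a : G, (fun x : X => a • x) '' V = V) ∧
      IsSmoothTubularNhd g Y Z V (riemannianExp g) := by
  have hzero := isOpenNhdOfZeroSection_tubeSource (g := g) hY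
  have hexp0 : ∀ y, riemannianExp g (⟨y, (0 : E)⟩ : TangentBundle 𝓘(ℝ, E) X) = y :=
    riemannianExp_zero g
  have hYV : Y ⊆ riemannianExp g '' tubeSource g Y := fun y hy => ⟨_, hzero.2 y hy, hexp0 y⟩
  have hequi : ∀ a : G, ∀ p ∈ tubeSource g Y,
      riemannianExp g (tangentAct E a p) = a • riemannianExp g p := fun a p hp =>
    riemannianExp_tangentAct hG a (tubeSource_subset hp).1
  have hmaps : ∀ a : G, ∀ p ∈ tubeSource g Y, tangentAct E a p ∈ tubeSource g Y :=
    fun a p hp => tangentAct_mem_tubeSource hG hGY a hp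
  have hmapsV : ∀ a : G, ∀ x ∈ riemannianExp g '' tubeSource g Y,
      a • x ∈ riemannianExp g '' tubeSource g Y := by
    rintro a _ ⟨p, hp, rfl⟩
    exact ⟨_, hmaps a p hp, hequi a p hp⟩
  refine ⟨tubeSource g Y, riemannianExp g '' tubeSource g Y, hzero, tubeSource_subset,
    fun a => Subset.antisymm (image_subset_iff.2 (hmaps a)) fun p hp =>
      ⟨_, hmaps a⁻¹ p hp, tangentAct_tangentAct_inv hG a p⟩,
    isOpen_image_tubeSource, hYV, isDiffeoOn_tubeSource, hequi,
    fun a => Subset.antisymm (image_subset_iff.2 (hmapsV a)) fun x hx =>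
      ⟨_, hmapsV a⁻¹ x hx, smul_inv_smul a x⟩,
    hzero, isOpen_image_tubeSource, hYV, isDiffeoOn_tubeSource, fun y _ => hexp0 y⟩
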